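/- **Setting.** Let $d_x,d_u\ge 1$, $d=\max(d_x,d_u)$, and consider the linear dynamical system $x_{t+1}=Ax_t+Bu_t+w_t$, $x_1=0$, with real matrices $A\in\mathbb R^{d_x\times d_x}$, $B\in\mathbb R^{d_x\times d_u}$. All matrix norms are spectral norms. The perturbations $w_t$ are i.i.d. with a law $\mathcal D_w$ such that $\mathbb E[w_t]=0$, $\mathbb E[w_tw_t^\top]\succeq\sigma^2 I$ ($\sigma>0$), and $\|w_t\|\le W$ almost surely; put $w_s=0$ for $s\le 0$. For $\kappa\ge 1$ and $0<\gamma<1$, a real matrix $K$ is $(\kappa,\gamma)$-diagonal strongly stable if $A-BK=QLQ^{-1}$ with a complex diagonal $L$ and a non-singular complex $Q$ with $\|L\|\le 1-\gamma$, $\|K\|\le\kappa$, $\|Q\|,\|Q^{-1}\|\le\kappa$. Let $\mathcal K$ be the set of these matrices and fix $\mathbb K\in\mathcal K$. Let $\kappa_B\ge\|B\|$ be an upper bound with $\kappa_B(1-\gamma)\ge 2$. The costs $c_t(x,u)$ are a fixed sequence of differentiable functions that are $\alpha$-strongly convex in $(x,u)$ ($\alpha>0$) and satisfy, for every $D\ge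 W$, $\|\nabla_xc_t(x,u)\|,\|\nabla_uc_t(x,u)\|\le GD$ whenever $\|x\|,\|u\|\le D$. For a controller $\mathcal A$ let $J_T(\mathcal A)=\mathbb E\big[\sum_{t=1}^Tc_t(x_t,u_t)\big]$, and let $J_T(K)$ be the cost of the controller $u_t=-Kx_t$. **Algorithm.** Let $T\ge 2$, $H=\lceil\gamma^{-1}\log(T\kappa^2)\rceil$, and $\mathcal M=\{M=(M^{[0]},\dots,M^{[H-1]}):M^{[i-1]}\in\mathbb R^{d_u\times d_x},\ \|M^{[i-1]}\|\le\kappa^3\kappa_B(1-\gamma)^i \text{ for } 1\le i\le H\}$; write $M_{\mathrm{vec}}$ for the flattening of $M$. With $\tilde A=A-B\mathbb K$ and $$\Psi_i(M)=\tilde A^i\mathbf 1_{i\le H}+\sum_{j=0}^H\tilde A^jBM^{[i-j-1]}\mathbf 1_{i-j\in[1,H]},$$ and independent $w_0,\dots,w_{2H-1}\sim\mathcal D_w$, the surrogate state, action and cost are $$y(M)=\sum_{i=0}^{2H-1}\Psi_i(M)w_{2H-1-i},\qquad v(M)=-\mathbb Ky(M)+\sum_{i=1}^HM^{[i-1]}w_{2H-i},\qquad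 f_t(M)=\mathbb E[c_t(y(M),v(M))],$$ and $J$ is the (random) Jacobian of the affine map $M_{\mathrm{vec}}\mapsto(y(M),v(M))$. The online natural gradient algorithm $\mathcal A$ starts from an arbitrary $M_1\in\mathcal M$, plays $u_t=-\mathbb Kx_t+\sum_{i=1}^HM_t^{[i-1]}w_{t-i}$, and updates $$[M_{t+1}]_{\mathrm{vec}}=\Pi_{\mathcal M}\Big([M_t]_{\mathrm{vec}}-\eta_t\,(\mathbb E[J^\top J])^{-1}\nabla_{M_{\mathrm{vec}}}f_t(M_t)\Big),\qquad \eta_t=\frac{s}{\alpha t},$$ where $s\ge1$ is a constant and $\Pi_{\mathcal M}$ is the projection onto $\mathcal M$ in the norm $\|m\|^2=m^\top\mathbb E[J^\top J]\,m$. **Claim.** There are universal constants $C>0$ and $n\in\mathbb N$ such that, in every such situation, $$\mathbb E[J^\top J]\succeq\frac{\gamma^2\sigma^2}{36\,\kappa^{10}}\,I$$ and $$J_T(\mathcal A)-\min_{K\in\mathcal K}J_T(K)\ \le\ C\,(\gamma^{-1}\kappa_B\,\kappa\,d)^n\, s\,\frac{G^2W^4}{\alpha\sigma^2}\,\log^7T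 .$$ -/

import Mathlib

open MeasureTheory ProbabilityTheory
open scoped Matrix Matrix.Norms.L2Operator

noncomputable section

namespace OnlineControl

/-- `ℝⁿ` with the Euclidean norm. -/
abbrev Vec (n : ℕ) := EuclideanSpace ℝ (Fin n)

/-- Flattened disturbance-action parameters `M_vec`, with the Euclidean norm; the coordinate
`(i, a, b)` is the entry `(a, b)` of the `du × dx` matrix `M^{[i]}`, `i = 0, …, H - 1`. -/
abbrev Param (H du dx : ℕ) := EuclideanSpace ℝ (Fin H × Fin du × Fin dx)

/-- The matrix `M^{[i]}` of a flattened parameter. -/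
def block {H du dx : ℕ} (M : Param H du dx) (i : Fin H) : Matrix (Fin du) (Fin dx) ℝ :=
  Matrix.of fun a b => M (i, a, b)

/-- The action of a matrix on a Euclidean vector. -/
abbrev app {m n : ℕ} (A : Matrix (Fin m) (Fin n) ℝ) (x : Vec n) : Vec m :=
  Matrix.toEuclideanLin A x

/-- `K` is `(κ, γ)`-diagonal strongly stable for the dynamics `(A, B)`. All matrix norms are
spectral norms. -/
def DiagStronglyStable {dx du : ℕ} (A : Matrix (Fin dx) (Fin dx) ℝ)
    (B : Matrix (Fin dx) (Fin du) ℝ) (κ γ : ℝ) (K : Matrix (Fin du) (Fin dx) ℝ) : Prop :=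
  ∃ (L : Fin dx → ℂ) (Q : Matrix (Fin dx) (Fin dx) ℂ),
    IsUnit Q.det ∧
    (A - B * K).map Complex.ofReal = Q * Matrix.diagonal L * Q⁻¹ ∧
    ‖(Matrix.diagonal L : Matrix (Fin dx) (Fin dx) ℂ)‖ ≤ 1 - γ ∧
    ‖K‖ ≤ κ ∧ ‖Q‖ ≤ κ ∧ ‖Q⁻¹‖ ≤ κ

/-- Covariance matrix `E[w wᵀ]` of a centred law `μ`. -/
def secondMoment {dx : ℕ} (μ : Measure (Vec dx)) : Matrix (Fin dx) (Fin dx) ℝ :=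
  Matrix.of fun a b => ∫ x, x a * x b ∂μ

/-- The law of one perturbation: zero mean, `E[w wᵀ] ⪰ σ² I`, and `‖w‖ ≤ W` almost surely. -/
structure NoiseLaw {dx : ℕ} (μ : Measure (Vec dx)) (σ W : ℝ) : Prop where
  prob : IsProbabilityMeasure μ
  bounded : ∀ᵐ x ∂μ, ‖x‖ ≤ W
  mean_zero : ∫ x, x ∂μ = 0
  cov : (secondMoment μ - (σ ^ 2) • (1 : Matrix (Fin dx) (Fin dx) ℝ)).PosSemidef

/-- Conditions on one cost function: differentiable, `α`-strongly convex jointly in `(x, u)` for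
the Euclidean norm, and with both partial gradients bounded by `G D` as long as
`‖x‖, ‖u‖ ≤ D`. The last condition is only asked for scales `D` that are at least the noise
bound `W`, so the cost need not be minimal at the origin. -/
structure CostCondition {dx du : ℕ} (c : Vec dx → Vec du → ℝ) (α G W : ℝ) : Prop where
  differentiable : Differentiable ℝ (fun z : Vec dx × Vec du => c z.1 z.2)
  strongConvex :
    StrongConvexOn Set.univ α (fun z : WithLp 2 (Vec dx × Vec du) => c z.fst z.snd)
  grad_bound : ∀ D : ℝ, W ≤ D → ∀ (x : Vec dx) (u : Vec du), ‖x‖ ≤ D → ‖u‖ ≤ D →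
    ‖gradient (fun x' => c x' u) x‖ ≤ G * D ∧ ‖gradient (fun u' => c x u') u‖ ≤ G * D

/-! ### The controlled system -/

/-- The state `x_t`, `t ≥ 1`, of `x_{t+1} = A x_t + B u_t + w_t`, `x_1 = 0`, where the action is
`u_t = π t x_t` (the value at `t = 0` is not used). -/
def state {dx du : ℕ} (A : Matrix (Fin dx) (Fin dx) ℝ) (B : Matrix (Fin dx) (Fin du) ℝ)
    (π : ℕ → Vec dx → Vec du) (w : ℕ → Vec dx) : ℕ → Vec dx
  | 0 => 0
  | 1 => 0
  | t + 2 =>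
      app A (state A B π w (t + 1)) + app B (π (t + 1) (state A B π w (t + 1))) + w (t + 1)

/-- `J_T = E[∑_{t=1}^T c_t(x_t, u_t)]` for a controller that, given the noise `w`, plays
`u_t = π w t x_t`. -/
def expectedCost {dx du : ℕ} {Ω : Type*} [MeasurableSpace Ω] (P : Measure Ω)
    (w : ℕ → Ω → Vec dx)
    (A : Matrix (Fin dx) (Fin dx) ℝ) (B : Matrix (Fin dx) (Fin du) ℝ)
    (c : ℕ → Vec dx → Vec du → ℝ) (T : ℕ)
    (π : (ℕ → Vec dx) → ℕ → Vec dx → Vec du) : ℝ :=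
  ∫ ω, ∑ t ∈ Finset.Icc 1 T,
    c t (state A B (π fun s => w s ω) (fun s => w s ω) t)
      (π (fun s => w s ω) t (state A B (π fun s => w s ω) (fun s => w s ω) t)) ∂P

/-- The linear controller `u_t = -K x_t`. -/
def linearController {dx du : ℕ} (K : Matrix (Fin du) (Fin dx) ℝ) :
    (ℕ → Vec dx) → ℕ → Vec dx → Vec du :=
  fun _ _ x => -app K x

/-- The disturbance-action controller `u_t = -𝕂 x_t + ∑_{i=1}^H M_t^{[i-1]} w_{t-i}`, where
`w_s = 0` for `s ≤ 0`. It only uses `w_s` for `1 ≤ s < t`, and these are known at time `t`, as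
`w_s = x_{s+1} - A x_s - B u_s`. -/
def disturbanceActionController {dx du H : ℕ} (K : Matrix (Fin du) (Fin dx) ℝ)
    (M : ℕ → Param H du dx) : (ℕ → Vec dx) → ℕ → Vec dx → Vec du :=
  fun w t x => -app K x +
    ∑ i : Fin H, if (i : ℕ) + 1 < t then app (block (M t) i) (w (t - ((i : ℕ) + 1))) else 0

/-! ### Surrogate state, action and cost -/

/-- The transfer matrix
`Ψ_i(M) = Ã^i 1_{i ≤ H} + ∑_{j=0}^H Ã^j B M^{[i-j-1]} 1_{i-j ∈ [1,H]}` with `Ã = A - B 𝕂`. -/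
def transfer {dx du H : ℕ} (A : Matrix (Fin dx) (Fin dx) ℝ) (B : Matrix (Fin dx) (Fin du) ℝ)
    (K : Matrix (Fin du) (Fin dx) ℝ) (M : Param H du dx) (i : ℕ) :
    Matrix (Fin dx) (Fin dx) ℝ :=
  (if i ≤ H then (A - B * K) ^ i else 0) +
    ∑ j ∈ Finset.range (H + 1),
      if h : j < i ∧ i - j ≤ H then
        (A - B * K) ^ j * B * block M ⟨i - j - 1, by omega⟩
      else 0

/-- Surrogate state `y(M) = ∑_{i=0}^{2H-1} Ψ_i(M) w_{2H-1-i}`, driven by `w_0, …, w_{2H-1}`. -/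
def surrogateState {dx du H : ℕ} (A : Matrix (Fin dx) (Fin dx) ℝ)
    (B : Matrix (Fin dx) (Fin du) ℝ) (K : Matrix (Fin du) (Fin dx) ℝ) (M : Param H du dx)
    (w : Fin (2 * H) → Vec dx) : Vec dx :=
  ∑ i : Fin (2 * H), app (transfer A B K M i) (w i.rev)

/-- Surrogate action `v(M) = -𝕂 y(M) + ∑_{i=1}^H M^{[i-1]} w_{2H-i}`. -/
def surrogateAction {dx du H : ℕ} (A : Matrix (Fin dx) (Fin dx) ℝ)
    (B : Matrix (Fin dx) (Fin du) ℝ) (K : Matrix (Fin du) (Fin dx) ℝ) (M : Param H du dx)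
    (w : Fin (2 * H) → Vec dx) : Vec du :=
  -app K (surrogateState A B K M w) +
    ∑ i : Fin H, app (block M i) (w ⟨2 * H - ((i : ℕ) + 1), by have := i.isLt; omega⟩)

/-- Surrogate cost `f(M) = E[c(y(M), v(M))]`, the expectation being over `2H` independent noise
vectors of law `μ`. -/
def surrogateCost {dx du H : ℕ} (μ : Measure (Vec dx)) (A : Matrix (Fin dx) (Fin dx) ℝ)
    (B : Matrix (Fin dx) (Fin du) ℝ) (K : Matrix (Fin du) (Fin dx) ℝ)
    (c : Vec dx → Vec du → ℝ) (M : Param H du dx) : ℝ :=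
  ∫ w, c (surrogateState A B K M w) (surrogateAction A B K M w)
    ∂(Measure.pi fun _ : Fin (2 * H) => μ)

/-- The coordinates of `z(M) = (y(M), v(M))`. -/
def surrogatePair {dx du H : ℕ} (A : Matrix (Fin dx) (Fin dx) ℝ)
    (B : Matrix (Fin dx) (Fin du) ℝ) (K : Matrix (Fin du) (Fin dx) ℝ) (M : Param H du dx)
    (w : Fin (2 * H) → Vec dx) : Fin dx ⊕ Fin du → ℝ :=
  Sum.elim (fun r => surrogateState A B K M w r) (fun r => surrogateAction A B K M w r)

/-- The random Jacobian `J` of `z(M)` with respect to `M_vec`. Since `z` is affine in `M_vec`, the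
column of `J` that belongs to the coordinate `p` is `z(e_p) - z(0)`. -/
def jacobian {dx du H : ℕ} (A : Matrix (Fin dx) (Fin dx) ℝ)
    (B : Matrix (Fin dx) (Fin du) ℝ) (K : Matrix (Fin du) (Fin dx) ℝ)
    (w : Fin (2 * H) → Vec dx) :
    Matrix (Fin dx ⊕ Fin du) (Fin H × Fin du × Fin dx) ℝ :=
  Matrix.of fun r p =>
    surrogatePair A B K (EuclideanSpace.single p 1) w r - surrogatePair A B K 0 w r

/-- The preconditioner `E[Jᵀ J]`. -/
def expectedGram {dx du : ℕ} (H : ℕ) (μ : Measure (Vec dx)) (A : Matrix (Fin dx) (Fin dx) ℝ)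
    (B : Matrix (Fin dx) (Fin du) ℝ) (K : Matrix (Fin du) (Fin dx) ℝ) :
    Matrix (Fin H × Fin du × Fin dx) (Fin H × Fin du × Fin dx) ℝ :=
  Matrix.of fun p q => ∫ w, ((jacobian A B K w)ᵀ * jacobian A B K w) p q
    ∂(Measure.pi fun _ : Fin (2 * H) => μ)

/-! ### The online natural gradient algorithm -/

/-- The feasible set `{M : ‖M^{[i-1]}‖ ≤ κ³ κ_B (1 - γ)^i, i = 1, …, H}`. -/
def feasible (H du dx : ℕ) (κ κB γ : ℝ) : Set (Param H du dx) :=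
  {M | ∀ i : Fin H, ‖block M i‖ ≤ κ ^ 3 * κB * (1 - γ) ^ ((i : ℕ) + 1)}

/-- The squared norm `‖m‖_P² = mᵀ P m`. -/
def sqNorm {ι : Type*} [Fintype ι] (P : Matrix ι ι ℝ) (m : EuclideanSpace ℝ ι) : ℝ :=
  m.ofLp ⬝ᵥ (P *ᵥ m.ofLp)

/-- `N` is the projection of `Y` onto `S` in the norm `‖·‖_P`. -/
def IsProj {ι : Type*} [Fintype ι] (P : Matrix ι ι ℝ) (S : Set (EuclideanSpace ℝ ι))
    (Y N : EuclideanSpace ℝ ι) : Prop :=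
  N ∈ S ∧ ∀ N' ∈ S, sqNorm P (N - Y) ≤ sqNorm P (N' - Y)

/-- `M_1, …, M_T` are the iterates of the online natural gradient update
`M_{t+1} = Π(M_t - η_t (E[Jᵀ J])⁻¹ ∇ f_t(M_t))`, from an arbitrary feasible `M_1`, where `Π` is
the projection onto the feasible set in the norm given by `E[Jᵀ J]`. -/
def NaturalGradientIterates {dx du H : ℕ} (μ : Measure (Vec dx))
    (A : Matrix (Fin dx) (Fin dx) ℝ) (B : Matrix (Fin dx) (Fin du) ℝ)
    (K : Matrix (Fin du) (Fin dx) ℝ) (κ κB γ : ℝ) (c : ℕ → Vec dx → Vec du → ℝ)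
    (η : ℕ → ℝ) (T : ℕ) (M : ℕ → Param H du dx) : Prop :=
  M 1 ∈ feasible H du dx κ κB γ ∧
  ∀ t : ℕ, 1 ≤ t → t < T →
    IsProj (expectedGram H μ A B K) (feasible H du dx κ κB γ)
      (M t - η t • WithLp.toLp 2 ((expectedGram H μ A B K)⁻¹ *ᵥ
        (gradient (surrogateCost μ A B K (c t)) (M t)).ofLp))
      (M (t + 1))

end OnlineControl

end

/-! The lower bound on `E[JᵀJ]` rests on one cancellation: `v(M) + 𝕂 y(M)` is the bare disturbance
action `∑ M^{[i-1]} w_{2H-i}`, in which `A` and `B` no longer occur. The noise vectors are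
independent and centred with covariance at least `σ² I`, so the mean square of this action is at
least `σ² ‖M‖²` (`NoiseLaw.le_integral_lagAction`). Since `‖𝕂‖ ≤ κ`, it is also at most `1 + κ²`
times the mean square of the response of `(y, v)`. Hence `E[JᵀJ] ⪰ σ² / (1 + κ²)`, which is stronger
than the claim.

For the regret, fix a competitor `K` and insert surrogate costs: the difference of costs is (true
cost − `f_t(M_t)`) + (`f_t(M_t)` − `f_t(M⋆)`) + (`f_t(M⋆)` − cost of `K`), where `M⋆` is the
parameter `imitation`, whose blocks are `(𝕂 − K)(A − BK)^i`.

Middle term: `(y, v)` is affine in `M`, so `f_t` is `α`-strongly convex in the norm of `E[JᵀJ]`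
itself, with no loss from its smallest eigenvalue, and in the dual norm its gradient has square at
most `2 (G D)²`, where `D = 3 β¹⁰ W` bounds all states and actions. Projected descent in this norm
with steps `s / (α t)` then has regret at most `(s / α) (G D)² (1 + log T)`
(`sum_le_of_strongly_convex_descent`).

Outer terms: a trajectory of the stable closed loop depends on the past beyond `H` steps only up to
a factor `(1 - γ)^H ≤ 1 / T`, so it agrees with the surrogate on the same noise up to `O(1 / T)`
and, for the algorithm, the movement of the iterates over the last `H + 1` rounds
(`StableRegime.norm_sub_surrogate_le`). Only here does the eigenvalue bound enter the regret: it
shows that consecutive iterates are within `O(1 / t)`, so the total movement cost is of order `H²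
log T`. The first `2 H + 1` rounds, too short for a full window, are paid for crudely.

The update uses expected costs, so the iterates are deterministic and any window of `2 H`
consecutive noise vectors has the product law that defines `f_t`. All constants are bounded by
powers of `β = γ⁻¹ κ_B κ d`; the argument gives `log³ T`, which `regret_arithmetic` relaxes to `log⁷
T`. -/

namespace OnlineControl

/-! ### Matrices acting on Euclidean vectors -/

section Matrices

variable {l m n : ℕ}

theorem norm_app_le (A : Matrix (Fin m) (Fin n) ℝ) (x : Vec n) : ‖app A x‖ ≤ ‖A‖ * ‖x‖ :=
  Matrix.l2_opNorm_mulVec A x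

theorem norm_app_le_of_le {A : Matrix (Fin m) (Fin n) ℝ} {x : Vec n} {a b : ℝ} (hA : ‖A‖ ≤ a)
    (hx : ‖x‖ ≤ b) : ‖app A x‖ ≤ a * b :=
  (norm_app_le A x).trans
    (mul_le_mul hA hx (norm_nonneg _) ((norm_nonneg _).trans hA))

theorem app_apply (A : Matrix (Fin m) (Fin n) ℝ) (x : Vec n) (a : Fin m) :
    app A x a = ∑ b, A a b * x b := by
  simp [app, Matrix.toLpLin_apply, Matrix.mulVec, dotProduct]

theorem app_mul (A : Matrix (Fin l) (Fin m) ℝ) (B : Matrix (Fin m) (Fin n) ℝ) (x : Vec n) :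
    app (A * B) x = app A (app B x) := by
  simp [app, Matrix.toLpLin_apply]

theorem app_one (x : Vec n) : app (1 : Matrix (Fin n) (Fin n) ℝ) x = x := by
  simp [app]

theorem app_sub_left (A B : Matrix (Fin m) (Fin n) ℝ) (x : Vec n) :
    app (A - B) x = app A x - app B x := by
  simp [app]

theorem app_add_left (A B : Matrix (Fin m) (Fin n) ℝ) (x : Vec n) :
    app (A + B) x = app A x + app B x := by
  simp [app]

theorem app_zero (A : Matrix (Fin m) (Fin n) ℝ) : app A 0 = 0 := map_zero _

theorem app_add (A : Matrix (Fin m) (Fin n) ℝ) (x y : Vec n) : app A (x + y) = app A x + app A y :=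
  map_add _ _ _

theorem app_sub (A : Matrix (Fin m) (Fin n) ℝ) (x y : Vec n) : app A (x - y) = app A x - app A y :=
  map_sub _ _ _

theorem app_sum {ι : Type*} (A : Matrix (Fin m) (Fin n) ℝ) (s : Finset ι) (f : ι → Vec n) :
    app A (∑ i ∈ s, f i) = ∑ i ∈ s, app A (f i) :=
  map_sum _ _ _

theorem continuous_app (A : Matrix (Fin m) (Fin n) ℝ) : Continuous (app A) :=
  LinearMap.continuous_of_finiteDimensional _

/-- Real vectors are complex vectors of the same norm. This brings bounds from the complex
diagonalisation back to the real closed loop. -/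
theorem norm_le_norm_map_ofReal (A : Matrix (Fin m) (Fin n) ℝ) :
    ‖A‖ ≤ ‖A.map Complex.ofReal‖ := by
  rw [Matrix.l2_opNorm_def]
  refine ContinuousLinearMap.opNorm_le_bound _ (norm_nonneg _) fun x => ?_
  have h := Matrix.l2_opNorm_mulVec (A.map Complex.ofReal)
    (WithLp.toLp 2 fun i => (x i : ℂ) : EuclideanSpace ℂ (Fin n))
  have hx : ‖(WithLp.toLp 2 fun i => (x i : ℂ) : EuclideanSpace ℂ (Fin n))‖ = ‖x‖ := by
    simp [EuclideanSpace.norm_eq]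
  rw [hx] at h
  refine le_trans (le_of_eq ?_) h
  rw [EuclideanSpace.norm_eq, EuclideanSpace.norm_eq]
  congr 1
  refine Finset.sum_congr rfl fun i _ => ?_
  congr 1
  have : (A.map Complex.ofReal *ᵥ fun i => (x i : ℂ)) i = ((A *ᵥ x.ofLp) i : ℂ) := by
    simp [Matrix.mulVec, dotProduct]
  change ‖(A *ᵥ x.ofLp) i‖ = ‖(A.map Complex.ofReal *ᵥ fun i => (x i : ℂ)) i‖
  rw [this, Complex.norm_real]

/-- The inner factors `Q⁻¹ Q` cancel in `F ^ k`, so the condition number `κ²` is paid once and not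
once per power. -/
theorem diagonal_stable_pow_norm_le {κ γ : ℝ} (hγ : γ ≤ 1) {L : Fin n → ℂ}
    {Q : Matrix (Fin n) (Fin n) ℂ} {F : Matrix (Fin n) (Fin n) ℝ} (hQ : IsUnit Q.det)
    (hF : F.map Complex.ofReal = Q * Matrix.diagonal L * Q⁻¹)
    (hL : ‖(Matrix.diagonal L : Matrix (Fin n) (Fin n) ℂ)‖ ≤ 1 - γ) (hκ : ‖Q‖ ≤ κ)
    (hκ' : ‖Q⁻¹‖ ≤ κ) (k : ℕ) : ‖F ^ k‖ ≤ κ ^ 2 * (1 - γ) ^ k := by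
  have hpow : (F ^ k).map Complex.ofReal = Q * Matrix.diagonal (L ^ k) * Q⁻¹ := by
    have h1 : (F ^ k).map Complex.ofReal = (F.map Complex.ofReal) ^ k :=
      map_pow (Complex.ofRealHom.mapMatrix) F k
    rw [h1, hF]
    induction k with
    | zero => simp [Matrix.mul_nonsing_inv Q hQ]
    | succ k ih =>
      have hs : Matrix.diagonal (L ^ (k + 1)) = Matrix.diagonal (L ^ k) * Matrix.diagonal L := by
        rw [Matrix.diagonal_mul_diagonal, pow_succ]
        rfl
      rw [pow_succ, ih (map_pow (Complex.ofRealHom.mapMatrix) F k), hs]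
      simp only [Matrix.mul_assoc]
      rw [Matrix.nonsing_inv_mul_cancel_left _ _ hQ]
  have hd : ‖(Matrix.diagonal (L ^ k) : Matrix (Fin n) (Fin n) ℂ)‖ ≤ (1 - γ) ^ k := by
    rw [Matrix.l2_opNorm_diagonal] at hL ⊢
    refine (pi_norm_le_iff_of_nonneg (by have := sub_nonneg.2 hγ; positivity)).2 fun i => ?_
    rw [Pi.pow_apply, norm_pow]
    exact pow_le_pow_left₀ (norm_nonneg _) ((norm_le_pi_norm L i).trans hL) k
  have h0 : 0 ≤ κ := (norm_nonneg _).trans hκ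
  have h1 : 0 ≤ (1 - γ) ^ k := (norm_nonneg _).trans hd
  calc ‖F ^ k‖ ≤ ‖(F ^ k).map Complex.ofReal‖ := norm_le_norm_map_ofReal _
    _ = ‖Q * Matrix.diagonal (L ^ k) * Q⁻¹‖ := by rw [hpow]
    _ ≤ ‖Q‖ * ‖(Matrix.diagonal (L ^ k) : Matrix (Fin n) (Fin n) ℂ)‖ * ‖Q⁻¹‖ :=
      (Matrix.l2_opNorm_mul _ _).trans
        (mul_le_mul_of_nonneg_right (Matrix.l2_opNorm_mul _ _) (norm_nonneg _))
    _ ≤ κ * (1 - γ) ^ k * κ := by gcongr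
    _ = κ ^ 2 * (1 - γ) ^ k := by ring

theorem DiagStronglyStable.pow_norm_le {dx du : ℕ} {A : Matrix (Fin dx) (Fin dx) ℝ}
    {B : Matrix (Fin dx) (Fin du) ℝ} {κ γ : ℝ} {K : Matrix (Fin du) (Fin dx) ℝ}
    (h : DiagStronglyStable A B κ γ K) (hγ : γ ≤ 1) (k : ℕ) :
    ‖(A - B * K) ^ k‖ ≤ κ ^ 2 * (1 - γ) ^ k := by
  obtain ⟨L, Q, hQ, hF, hL, -, hκ, hκ'⟩ := h
  exact diagonal_stable_pow_norm_le hγ hQ hF hL hκ hκ' k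

theorem DiagStronglyStable.norm_le {dx du : ℕ} {A : Matrix (Fin dx) (Fin dx) ℝ}
    {B : Matrix (Fin dx) (Fin du) ℝ} {κ γ : ℝ} {K : Matrix (Fin du) (Fin dx) ℝ}
    (h : DiagStronglyStable A B κ γ K) : ‖K‖ ≤ κ := by
  obtain ⟨L, Q, -, -, -, hK, -, -⟩ := h
  exact hK

end Matrices

/-! ### Blocks of a parameter vector -/

section Blocks

variable {H du dx : ℕ}

theorem block_add (M N : Param H du dx) (i : Fin H) : block (M + N) i = block M i + block N i := rfl

theorem block_smul (r : ℝ) (M : Param H du dx) (i : Fin H) : block (r • M) i = r • block M i := rfl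

theorem norm_sq_eq_sum_block (M : Param H du dx) :
    ‖M‖ ^ 2 = ∑ i : Fin H, ∑ a, ∑ b, block M i a b ^ 2 := by
  rw [EuclideanSpace.norm_sq_eq, Fintype.sum_prod_type]
  refine Finset.sum_congr rfl fun i _ => ?_
  rw [Fintype.sum_prod_type]
  simp [block]

/-- The operator norm of a block is at most its Frobenius norm, by Cauchy–Schwarz in each row. It
lets the Euclidean movement of the iterates control the change of the actions. -/
theorem norm_app_block_le (M : Param H du dx) (i : Fin H) (x : Vec dx) :
    ‖app (block M i) x‖ ≤ ‖M‖ * ‖x‖ := by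
  refine abs_le_of_sq_le_sq' ?_ (by positivity) |>.2
  rw [mul_pow, norm_sq_eq_sum_block, EuclideanSpace.norm_sq_eq]
  calc ∑ a, ‖app (block M i) x a‖ ^ 2
      ≤ ∑ a, (∑ b, block M i a b ^ 2) * ‖x‖ ^ 2 := by
        refine Finset.sum_le_sum fun a _ => ?_
        rw [Real.norm_eq_abs, sq_abs, app_apply, EuclideanSpace.norm_sq_eq]
        simp only [Real.norm_eq_abs, sq_abs]
        exact Finset.sum_mul_sq_le_sq_mul_sq _ _ _
    _ = (∑ a, ∑ b, block M i a b ^ 2) * ‖x‖ ^ 2 := by rw [Finset.sum_mul]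
    _ ≤ _ := by
        refine mul_le_mul_of_nonneg_right ?_ (sq_nonneg _)
        exact Finset.single_le_sum (f := fun i => ∑ a, ∑ b, block M i a b ^ 2)
          (fun j _ => Finset.sum_nonneg fun a _ => Finset.sum_nonneg fun b _ => sq_nonneg _)
          (Finset.mem_univ i)

theorem convex_feasible {κ κB γ : ℝ} : Convex ℝ (feasible H du dx κ κB γ) := by
  intro M hM N hN a b ha hb hab i
  rw [block_add, block_smul, block_smul]
  calc ‖a • block M i + b • block N i‖ ≤ ‖a • block M i‖ + ‖b • block N i‖ := norm_add_le _ _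
    _ = a * ‖block M i‖ + b * ‖block N i‖ := by
      rw [norm_smul, norm_smul, Real.norm_of_nonneg ha, Real.norm_of_nonneg hb]
    _ ≤ a * (κ ^ 3 * κB * (1 - γ) ^ ((i : ℕ) + 1)) + b * (κ ^ 3 * κB * (1 - γ) ^ ((i : ℕ) + 1)) :=
      add_le_add (mul_le_mul_of_nonneg_left (hM i) ha) (mul_le_mul_of_nonneg_left (hN i) hb)
    _ = _ := by rw [← add_mul, hab, one_mul]

end Blocks

theorem sum_geometric_le {γ : ℝ} (hγ : 0 < γ) (hγ1 : γ < 1) (n : ℕ) :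
    ∑ j ∈ Finset.range n, (1 - γ) ^ j ≤ γ⁻¹ := by
  have h := Summable.sum_le_tsum (Finset.range n) (fun j _ => by have := hγ1.le; positivity)
    (summable_geometric_of_lt_one (sub_nonneg.2 hγ1.le) (by linarith : 1 - γ < 1))
  rwa [tsum_geometric_of_lt_one (sub_nonneg.2 hγ1.le) (by linarith), sub_sub_cancel] at h

/-! ### The surrogate state in terms of lagged noise -/

section Lag

variable {H du dx : ℕ}

/-- The noise `k + 1` steps before the current time, and zero outside the window. -/
noncomputable def lag (w : Fin (2 * H) → Vec dx) (k : ℕ) : Vec dx :=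
  if h : k < 2 * H then w (Fin.rev ⟨k, h⟩) else 0

/-- The disturbance action `j` steps before the current time for the lagged noise `v`. -/
noncomputable def lagAction (v : ℕ → Vec dx) (j : ℕ) : Param H du dx →ₗ[ℝ] Vec du where
  toFun M := ∑ i : Fin H, app (block M i) (v (j + i))
  map_add' M N := by
    rw [← Finset.sum_add_distrib]
    exact Finset.sum_congr rfl fun i _ => by rw [block_add, app_add_left]
  map_smul' r M := by
    rw [RingHom.id_apply, Finset.smul_sum]
    exact Finset.sum_congr rfl fun i _ => by simp [block_smul, app]

theorem lagAction_apply (v : ℕ → Vec dx) (j : ℕ) (M : Param H du dx) :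
    lagAction v j M = ∑ i : Fin H, app (block M i) (v (j + i)) := rfl

theorem lag_eq_zero {w : Fin (2 * H) → Vec dx} {k : ℕ} (hk : 2 * H ≤ k) : lag w k = 0 :=
  dif_neg (not_lt.2 hk)

theorem continuous_lag (k : ℕ) : Continuous fun w : Fin (2 * H) → Vec dx => lag w k := by
  unfold lag
  split_ifs
  · exact continuous_apply _
  · exact continuous_const

theorem continuous_lagAction (j : ℕ) (M : Param H du dx) :
    Continuous fun w : Fin (2 * H) → Vec dx => lagAction (lag w) j M := by
  simp only [lagAction_apply]
  exact continuous_finsetSum _ fun i _ => (continuous_app _).comp (continuous_lag _)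

variable (A : Matrix (Fin dx) (Fin dx) ℝ) (B : Matrix (Fin dx) (Fin du) ℝ)
  (K : Matrix (Fin du) (Fin dx) ℝ)

/-- Regrouping the double sum by the power of the closed loop, rather than by the noise index, shows
the surrogate state as the result of `H + 1` closed-loop steps started from zero. This is the shape
that `unroll` gives to true trajectories. -/
theorem surrogateState_eq (M : Param H du dx) (w : Fin (2 * H) → Vec dx) :
    surrogateState A B K M w =
      ∑ j ∈ Finset.range (H + 1),
        app ((A - B * K) ^ j) (lag w j + app B (lagAction (lag w) (j + 1) M)) := by
  have hlag : ∀ i : Fin (2 * H), w i.rev = lag w i := fun i => by simp [lag]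
  have h1 : ∑ k ∈ Finset.range (2 * H), (if k ≤ H then app ((A - B * K) ^ k) (lag w k) else 0) =
      ∑ j ∈ Finset.range (H + 1), app ((A - B * K) ^ j) (lag w j) := by
    rw [← Finset.sum_filter]
    refine Finset.sum_subset_zero_on_sdiff ?_ ?_ fun _ _ => rfl
    · intro k hk
      simp only [Finset.mem_filter, Finset.mem_range] at hk ⊢
      omega
    · intro k hk
      simp only [Finset.mem_sdiff, Finset.mem_filter, Finset.mem_range] at hk
      rw [lag_eq_zero (by omega), app_zero]
  have h2 : ∀ j ∈ Finset.range (H + 1), ∑ k ∈ Finset.range (2 * H),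
      app (if h : j < k ∧ k - j ≤ H then
        (A - B * K) ^ j * B * block M ⟨k - j - 1, by omega⟩ else 0) (lag w k) =
      app ((A - B * K) ^ j) (app B (lagAction (lag w) (j + 1) M)) := by
    intro j hj
    rw [Finset.mem_range] at hj
    set g : ℕ → Vec dx := fun k => app (if h : j < k ∧ k - j ≤ H then
        (A - B * K) ^ j * B * block M ⟨k - j - 1, by omega⟩ else 0) (lag w k) with hg
    have hL : ∑ k ∈ Finset.range (2 * H), g k = ∑ k ∈ Finset.Ico (j + 1) (j + 1 + H), g k := by
      -- For `j = H` the shifted interval reaches `k = 2 * H`, one past the window; `lag` is zero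
      -- there, so the range may be enlarged.
      have e1 : ∑ k ∈ Finset.range (2 * H), g k = ∑ k ∈ Finset.range (2 * H + 1), g k := by
        rw [Finset.sum_range_succ, hg]
        simp only
        rw [lag_eq_zero le_rfl, app_zero, add_zero]
      rw [e1]
      symm
      refine Finset.sum_subset ?_ ?_
      · intro k hk
        simp only [Finset.mem_Ico, Finset.mem_range] at hk ⊢
        omega
      · intro k _ hk
        simp only [Finset.mem_Ico] at hk
        rw [hg]
        simp only
        rw [dif_neg (by omega)]
        simp [app]
    rw [hL, Finset.sum_Ico_eq_sum_range, Nat.add_sub_cancel_left, Finset.sum_range, lagAction_apply,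
      app_sum, app_sum]
    refine Finset.sum_congr rfl fun i _ => ?_
    rw [hg]
    simp only
    rw [dif_pos (by omega), app_mul, app_mul]
    congr 4
    ext
    simp only
    omega
  unfold surrogateState
  simp only [hlag, app_add, Finset.sum_add_distrib]
  rw [← h1, ← Finset.sum_congr rfl h2, Finset.sum_comm, Finset.sum_range, Finset.sum_range,
    ← Finset.sum_add_distrib]
  refine Finset.sum_congr rfl fun k _ => ?_
  rw [transfer, app_add_left]
  congr 1
  · split_ifs
    · rfl
    · simp [app]
  · simp only [app, map_sum, LinearMap.sum_apply]

theorem surrogateAction_eq (M : Param H du dx) (w : Fin (2 * H) → Vec dx) :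
    surrogateAction A B K M w =
      -app K (surrogateState A B K M w) + lagAction (lag w) 0 M := by
  unfold surrogateAction
  rw [lagAction_apply]
  congr 1
  refine Finset.sum_congr rfl fun i _ => ?_
  have hi := i.isLt
  rw [lag, dif_pos (by omega)]
  congr 2
  ext
  simp only [Fin.val_rev]
  omega

/-- The linear part of the surrogate state as a function of the parameter. -/
noncomputable def stateResponse (w : Fin (2 * H) → Vec dx) : Param H du dx →ₗ[ℝ] Vec dx :=
  ∑ j ∈ Finset.range (H + 1),
    (Matrix.toEuclideanLin ((A - B * K) ^ j * B)).comp (lagAction (lag w) (j + 1))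

/-- The linear part of the surrogate action as a function of the parameter. -/
noncomputable def actionResponse (w : Fin (2 * H) → Vec dx) : Param H du dx →ₗ[ℝ] Vec du :=
  -(Matrix.toEuclideanLin K).comp (stateResponse A B K w) + lagAction (lag w) 0

theorem surrogateState_add (M N : Param H du dx) (w : Fin (2 * H) → Vec dx) :
    surrogateState A B K (M + N) w = surrogateState A B K M w + stateResponse A B K w N := by
  rw [surrogateState_eq, surrogateState_eq, stateResponse, LinearMap.sum_apply,
    ← Finset.sum_add_distrib]
  refine Finset.sum_congr rfl fun j _ => ?_
  have : (Matrix.toEuclideanLin ((A - B * K) ^ j * B)).comp (lagAction (lag w) (j + 1)) N =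
    app ((A - B * K) ^ j) (app B (lagAction (lag w) (j + 1) N)) := app_mul _ _ _
  rw [this, ← app_add, map_add (lagAction (lag w) (j + 1)), app_add B, add_assoc]

theorem surrogateAction_add (M N : Param H du dx) (w : Fin (2 * H) → Vec dx) :
    surrogateAction A B K (M + N) w = surrogateAction A B K M w + actionResponse A B K w N := by
  rw [surrogateAction_eq, surrogateAction_eq, surrogateState_add, app_add, map_add,
    actionResponse, LinearMap.add_apply, LinearMap.neg_apply, LinearMap.comp_apply]
  abel

/-- The feedback part cancels and leaves an expression free of `A` and `B`. This identity is the
source of the lower bound on the preconditioner. -/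
theorem actionResponse_add_app (w : Fin (2 * H) → Vec dx) (N : Param H du dx) :
    actionResponse A B K w N + app K (stateResponse A B K w N) = lagAction (lag w) 0 N := by
  rw [actionResponse, LinearMap.add_apply, LinearMap.neg_apply, LinearMap.comp_apply]
  abel

theorem continuous_surrogateState (M : Param H du dx) :
    Continuous (surrogateState A B K M) := by
  rw [show surrogateState A B K M = _ from funext fun w => surrogateState_eq A B K M w]
  exact continuous_finsetSum _ fun j _ => (continuous_app _).comp
    ((continuous_lag j).add ((continuous_app B).comp (continuous_lagAction _ _)))

theorem continuous_surrogateAction (M : Param H du dx) :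
    Continuous (surrogateAction A B K M) := by
  rw [show surrogateAction A B K M = _ from funext fun w => surrogateAction_eq A B K M w]
  exact ((continuous_app K).comp (continuous_surrogateState A B K M)).neg.add
    (continuous_lagAction _ _)

theorem continuous_stateResponse (N : Param H du dx) :
    Continuous fun w => stateResponse A B K w N := by
  have : (fun w => stateResponse A B K w N) =
      fun w => surrogateState A B K (0 + N) w - surrogateState A B K 0 w := by
    funext w
    rw [surrogateState_add, add_sub_cancel_left]
  rw [this]
  exact (continuous_surrogateState A B K _).sub (continuous_surrogateState A B K _)

theorem continuous_actionResponse (N : Param H du dx) :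
    Continuous fun w => actionResponse A B K w N := by
  have : (fun w => actionResponse A B K w N) =
      fun w => surrogateAction A B K (0 + N) w - surrogateAction A B K 0 w := by
    funext w
    rw [surrogateAction_add, add_sub_cancel_left]
  rw [this]
  exact (continuous_surrogateAction A B K _).sub (continuous_surrogateAction A B K _)

end Lag

/-! ### The noise law -/

section Noise

variable {dx : ℕ} {μ : Measure (Vec dx)} {σ W : ℝ}

theorem NoiseLaw.bound_nonneg (h : NoiseLaw μ σ W) : 0 ≤ W := by
  have := h.prob
  obtain ⟨x, hx⟩ := h.bounded.exists
  exact (norm_nonneg x).trans hx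

theorem NoiseLaw.ae_pi (h : NoiseLaw μ σ W) {N : ℕ} :
    ∀ᵐ w ∂(Measure.pi fun _ : Fin N => μ), ∀ i, ‖w i‖ ≤ W := by
  have := h.prob
  rw [ae_all_iff]
  intro i
  exact (measurePreserving_eval (fun _ : Fin N => μ) i).quasiMeasurePreserving.ae h.bounded

/-- Almost surely the noise lies in a compact ball, on which a continuous function is bounded. -/
theorem NoiseLaw.integrable_pi (h : NoiseLaw μ σ W) {N : ℕ} {f : (Fin N → Vec dx) → ℝ}
    (hf : Continuous f) : Integrable f (Measure.pi fun _ : Fin N => μ) := by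
  have := h.prob
  obtain ⟨C, hC⟩ := (isCompact_closedBall (0 : Fin N → Vec dx) W).exists_bound_of_continuousOn
    hf.continuousOn
  refine Integrable.of_bound hf.aestronglyMeasurable C ?_
  filter_upwards [h.ae_pi (N := N)] with w hw
  exact hC w (mem_closedBall_zero_iff.2 ((pi_norm_le_iff_of_nonneg h.bound_nonneg).2 hw))

theorem NoiseLaw.integrable (h : NoiseLaw μ σ W) {f : Vec dx → ℝ} (hf : Continuous f) :
    Integrable f μ := by
  have := h.prob
  obtain ⟨C, hC⟩ := (isCompact_closedBall (0 : Vec dx) W).exists_bound_of_continuousOn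
    hf.continuousOn
  refine Integrable.of_bound hf.aestronglyMeasurable C ?_
  filter_upwards [h.bounded] with w hw
  exact hC w (mem_closedBall_zero_iff.2 hw)

theorem NoiseLaw.le_quadratic (h : NoiseLaw μ σ W) (x : Fin dx → ℝ) :
    σ ^ 2 * ∑ b, x b ^ 2 ≤ ∑ b, ∑ b', x b * x b' * secondMoment μ b b' := by
  have h0 := h.cov.dotProduct_mulVec_nonneg x
  rw [Matrix.sub_mulVec, dotProduct_sub, Matrix.smul_mulVec, Matrix.one_mulVec, dotProduct_smul,
    sub_nonneg] at h0
  simp only [dotProduct, Matrix.mulVec, Pi.star_apply, star_trivial, smul_eq_mul] at h0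
  calc σ ^ 2 * ∑ b, x b ^ 2 = σ ^ 2 * ∑ b, x b * x b := by simp only [sq]
    _ ≤ _ := h0
    _ = _ := by
      refine Finset.sum_congr rfl fun b _ => ?_
      rw [Finset.mul_sum]
      exact Finset.sum_congr rfl fun b' _ => by ring

/-- A diagonal entry of the covariance lies between the two. The final estimate uses `W / σ ≥ 1` to
bring all error terms to the same power of `W / σ`. -/
theorem NoiseLaw.sigma_sq_le (h : NoiseLaw μ σ W) (hdx : 0 < dx) : σ ^ 2 ≤ W ^ 2 := by
  have := h.prob
  have h1 := h.le_quadratic (Pi.single ⟨0, hdx⟩ 1)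
  simp only [Pi.single_apply] at h1
  have h2 : σ ^ 2 ≤ secondMoment μ ⟨0, hdx⟩ ⟨0, hdx⟩ := by simpa using h1
  refine h2.trans ?_
  have h3 : ∫ x : Vec dx, x ⟨0, hdx⟩ * x ⟨0, hdx⟩ ∂μ ≤ ∫ _, W ^ 2 ∂μ := by
    refine integral_mono_ae (h.integrable (by fun_prop)) (integrable_const _) ?_
    filter_upwards [h.bounded] with x hx
    have := (PiLp.norm_apply_le x ⟨0, hdx⟩).trans hx
    rw [Real.norm_eq_abs] at this
    have := sq_le_sq.2 (this.trans (le_abs_self W))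
    simpa [sq] using this
  simpa [secondMoment] using h3

theorem NoiseLaw.integral_coord (h : NoiseLaw μ σ W) (b : Fin dx) : ∫ x, x b ∂μ = 0 := by
  have := h.prob
  have hint : Integrable (fun x : Vec dx => x) μ := by
    refine Integrable.of_bound (by fun_prop) W h.bounded
  have := (EuclideanSpace.proj b : Vec dx →L[ℝ] ℝ).integral_comp_comm hint
  rw [h.mean_zero, map_zero] at this
  simpa using this

theorem NoiseLaw.integral_pi_mul (h : NoiseLaw μ σ W) {N : ℕ} (i j : Fin N) (b b' : Fin dx) :
    ∫ w, w i b * w j b' ∂(Measure.pi fun _ : Fin N => μ) =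
      if i = j then secondMoment μ b b' else 0 := by
  have := h.prob
  have hcoord : ∀ (i : Fin N) (f : Vec dx → ℝ), Continuous f →
      ∫ w, f (w i) ∂(Measure.pi fun _ : Fin N => μ) = ∫ x, f x ∂μ := fun i f hf => by
    have hmp := measurePreserving_eval (fun _ : Fin N => μ) i
    conv_rhs => rw [← hmp.map_eq]
    rw [integral_map hmp.measurable.aemeasurable hf.aestronglyMeasurable]
  split_ifs with hij
  · subst hij
    exact hcoord i (fun x => x b * x b') (by fun_prop)
  · have hind : iIndepFun (fun (i : Fin N) (w : Fin N → Vec dx) => w i)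
        (Measure.pi fun _ : Fin N => μ) :=
      iIndepFun_pi (X := fun _ x => x) fun _ => aemeasurable_id
    have h2 := (hind.indepFun hij).comp
      (φ := fun x : Vec dx => x b) (ψ := fun x : Vec dx => x b')
      (by fun_prop) (by fun_prop)
    have h3 := h2.integral_fun_mul_eq_mul_integral
      (Continuous.aestronglyMeasurable (f := fun w : Fin N → Vec dx => w _ _) (by fun_prop))
      (Continuous.aestronglyMeasurable (f := fun w : Fin N → Vec dx => w _ _) (by fun_prop))
    simp only [Function.comp_apply] at h3
    rw [h3, hcoord i (fun x => x b) (by fun_prop), h.integral_coord, zero_mul]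

/-- Different blocks multiply independent centred vectors, so cross terms have mean zero, and each
row of each block contributes at least `σ²` times its squared length. -/
theorem NoiseLaw.le_integral_lagAction (h : NoiseLaw μ σ W) {H du : ℕ} (M : Param H du dx) :
    σ ^ 2 * ‖M‖ ^ 2 ≤
      ∫ w, ‖lagAction (lag w) 0 M‖ ^ 2 ∂(Measure.pi fun _ : Fin (2 * H) => μ) := by
  have := h.prob
  -- `ρ i` is the window position of the noise that meets block `i`; injectivity of `ρ` makes the
  -- noises of different blocks independent.
  set ρ : Fin H → Fin (2 * H) := fun i => Fin.rev ⟨i, by omega⟩ with hρ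
  have hρinj : ∀ i j, ρ i = ρ j ↔ i = j := by
    intro i j
    simp [hρ, Fin.ext_iff]
    omega
  have hlag : ∀ (w : Fin (2 * H) → Vec dx) (i : Fin H), lag w (0 + i) = w (ρ i) := by
    intro w i
    rw [lag, dif_pos (by omega)]
    simp [hρ]
  have hsq : ∀ w : Fin (2 * H) → Vec dx, ‖lagAction (lag w) 0 M‖ ^ 2 =
      ∑ a, ∑ i, ∑ j, ∑ b, ∑ b', block M i a b * block M j a b' * (w (ρ i) b * w (ρ j) b') := by
    intro w
    rw [EuclideanSpace.norm_sq_eq]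
    refine Finset.sum_congr rfl fun a _ => ?_
    have : lagAction (lag w) 0 M a = ∑ i, ∑ b, block M i a b * w (ρ i) b := by
      rw [lagAction_apply, WithLp.ofLp_sum, Finset.sum_apply]
      exact Finset.sum_congr rfl fun i _ => by rw [hlag, app_apply]
    rw [this, Real.norm_eq_abs, sq_abs, sq, Finset.sum_mul_sum]
    refine Finset.sum_congr rfl fun i _ => Finset.sum_congr rfl fun j _ => ?_
    rw [Finset.sum_mul_sum]
    exact Finset.sum_congr rfl fun b _ => Finset.sum_congr rfl fun b' _ => by ring
  have hint : ∀ (i j : Fin H) (a : Fin du) (b b' : Fin dx),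
      Integrable (fun w : Fin (2 * H) → Vec dx =>
        block M i a b * block M j a b' * (w (ρ i) b * w (ρ j) b'))
        (Measure.pi fun _ : Fin (2 * H) => μ) :=
    fun i j a b b' => h.integrable_pi (by fun_prop)
  simp only [hsq]
  rw [integral_finsetSum _ fun a _ => integrable_finsetSum _ fun i _ => integrable_finsetSum _
    fun j _ => integrable_finsetSum _ fun b _ => integrable_finsetSum _ fun b' _ => hint i j a b b']
  rw [norm_sq_eq_sum_block, Finset.sum_comm, Finset.mul_sum]
  refine Finset.sum_le_sum fun a _ => ?_
  rw [integral_finsetSum _ fun i _ => integrable_finsetSum _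
    fun j _ => integrable_finsetSum _ fun b _ => integrable_finsetSum _ fun b' _ => hint i j a b b',
    Finset.mul_sum]
  refine Finset.sum_le_sum fun i _ => ?_
  rw [integral_finsetSum _ fun j _ => integrable_finsetSum _ fun b _ => integrable_finsetSum _
    fun b' _ => hint i j a b b', Finset.sum_eq_single i]
  · rw [integral_finsetSum _ fun b _ => integrable_finsetSum _ fun b' _ => hint i i a b b']
    refine (h.le_quadratic fun b => block M i a b).trans (le_of_eq ?_)
    refine Finset.sum_congr rfl fun b _ => ?_
    rw [integral_finsetSum _ fun b' _ => hint i i a b b']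
    refine Finset.sum_congr rfl fun b' _ => ?_
    rw [integral_const_mul, h.integral_pi_mul, if_pos rfl]
  · intro j _ hj
    rw [integral_finsetSum _ fun b _ => integrable_finsetSum _ fun b' _ => hint i j a b b']
    refine Finset.sum_eq_zero fun b _ => ?_
    rw [integral_finsetSum _ fun b' _ => hint i j a b b']
    refine Finset.sum_eq_zero fun b' _ => ?_
    rw [integral_const_mul, h.integral_pi_mul, if_neg (fun e => hj ((hρinj _ _).1 e).symm),
      mul_zero]
  · simp

end Noise

/-! ### The preconditioner -/

section Gram

variable {dx du H : ℕ} {μ : Measure (Vec dx)} {σ W : ℝ}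
  (A : Matrix (Fin dx) (Fin dx) ℝ) (B : Matrix (Fin dx) (Fin du) ℝ)
  (K : Matrix (Fin du) (Fin dx) ℝ)

theorem jacobian_apply (w : Fin (2 * H) → Vec dx) (r : Fin dx ⊕ Fin du)
    (p : Fin H × Fin du × Fin dx) :
    jacobian A B K w r p = Sum.elim (stateResponse A B K w (EuclideanSpace.single p 1)).ofLp
      (actionResponse A B K w (EuclideanSpace.single p 1)).ofLp r := by
  have h1 := surrogateState_add A B K 0 (EuclideanSpace.single p 1) w
  have h2 := surrogateAction_add A B K 0 (EuclideanSpace.single p 1) w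
  rw [zero_add] at h1 h2
  simp only [jacobian, surrogatePair, Matrix.of_apply, h1, h2]
  rcases r with r | r <;> simp

theorem continuous_jacobian_apply (r : Fin dx ⊕ Fin du) (p : Fin H × Fin du × Fin dx) :
    Continuous fun w : Fin (2 * H) → Vec dx => jacobian A B K w r p := by
  simp only [jacobian_apply]
  have h1 := continuous_stateResponse A B K (EuclideanSpace.single p 1)
  have h2 := continuous_actionResponse A B K (EuclideanSpace.single p 1)
  rcases r with r | r <;> simp only [Sum.elim_inl, Sum.elim_inr] <;> fun_prop

theorem linearMap_eq_sum_single {ι : Type*} [Fintype ι] [DecidableEq ι] {V : Type*}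
    [AddCommGroup V] [Module ℝ V] (f : EuclideanSpace ℝ ι →ₗ[ℝ] V) (m : EuclideanSpace ℝ ι) :
    f m = ∑ p, m p • f (EuclideanSpace.single p 1) := by
  conv_lhs => rw [← (EuclideanSpace.basisFun ι ℝ).sum_repr m]
  simp

theorem jacobian_mulVec (w : Fin (2 * H) → Vec dx) (m : Param H du dx) :
    jacobian A B K w *ᵥ m.ofLp =
      Sum.elim (stateResponse A B K w m).ofLp (actionResponse A B K w m).ofLp := by
  funext r
  simp only [Matrix.mulVec, dotProduct, jacobian_apply]
  rcases r with r | r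
  · simp only [Sum.elim_inl]
    conv_rhs => rw [linearMap_eq_sum_single (stateResponse A B K w) m]
    simp [mul_comm]
  · simp only [Sum.elim_inr]
    conv_rhs => rw [linearMap_eq_sum_single (actionResponse A B K w) m]
    simp [mul_comm]

/-- The mean square response is what integrating the strong convexity and gradient bounds of the
costs produces, so this identity ties both to the norm used by the algorithm. -/
theorem sqNorm_expectedGram (h : NoiseLaw μ σ W) (m : Param H du dx) :
    sqNorm (expectedGram H μ A B K) m =
      ∫ w, (‖stateResponse A B K w m‖ ^ 2 + ‖actionResponse A B K w m‖ ^ 2)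
        ∂(Measure.pi fun _ : Fin (2 * H) => μ) := by
  have hint : ∀ p q, Integrable (fun w : Fin (2 * H) → Vec dx =>
      m p * (((jacobian A B K w)ᵀ * jacobian A B K w) p q * m q))
      (Measure.pi fun _ : Fin (2 * H) => μ) := by
    intro p q
    refine h.integrable_pi ?_
    simp only [Matrix.mul_apply, Matrix.transpose_apply]
    have := fun r p => continuous_jacobian_apply (H := H) A B K r p
    fun_prop
  have hpt : ∀ w : Fin (2 * H) → Vec dx,
      ‖stateResponse A B K w m‖ ^ 2 + ‖actionResponse A B K w m‖ ^ 2 =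
        ∑ p, ∑ q, m p * (((jacobian A B K w)ᵀ * jacobian A B K w) p q * m q) := by
    intro w
    have h1 : m.ofLp ⬝ᵥ (((jacobian A B K w)ᵀ * jacobian A B K w) *ᵥ m.ofLp) =
        (jacobian A B K w *ᵥ m.ofLp) ⬝ᵥ (jacobian A B K w *ᵥ m.ofLp) := by
      rw [← Matrix.mulVec_mulVec, Matrix.dotProduct_mulVec, Matrix.vecMul_transpose]
    rw [jacobian_mulVec] at h1
    simp only [dotProduct, Fintype.sum_sum_type, Sum.elim_inl, Sum.elim_inr, Matrix.mulVec,
      Finset.mul_sum] at h1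
    rw [h1, EuclideanSpace.norm_sq_eq, EuclideanSpace.norm_sq_eq]
    simp [sq]
  simp only [hpt]
  rw [integral_finsetSum _ fun p _ => integrable_finsetSum _ fun q _ => hint p q]
  simp only [sqNorm, dotProduct, Matrix.mulVec, Finset.mul_sum]
  refine Finset.sum_congr rfl fun p _ => ?_
  rw [integral_finsetSum _ fun q _ => hint p q]
  refine Finset.sum_congr rfl fun q _ => ?_
  rw [integral_const_mul, integral_mul_const]
  rfl

theorem isHermitian_expectedGram : (expectedGram H μ A B K).IsHermitian := by
  have hs : ∀ (w : Fin (2 * H) → Vec dx) (p q : Fin H × Fin du × Fin dx),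
      ((jacobian A B K w)ᵀ * jacobian A B K w) q p =
        ((jacobian A B K w)ᵀ * jacobian A B K w) p q := fun w p q => by
    simp only [Matrix.mul_apply, Matrix.transpose_apply]
    exact Finset.sum_congr rfl fun r _ => mul_comm _ _
  refine Matrix.IsHermitian.ext fun p q => ?_
  rw [star_trivial]
  exact integral_congr_ae (Filter.Eventually.of_forall fun w => hs w p q)

theorem le_sqNorm_expectedGram (h : NoiseLaw μ σ W) {κ γ : ℝ} (hκ : 1 ≤ κ) (hγ : 0 < γ)
    (hγ1 : γ < 1) (hK : ‖K‖ ≤ κ) (m : Param H du dx) :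
    γ ^ 2 * σ ^ 2 / (36 * κ ^ 10) * ‖m‖ ^ 2 ≤ sqNorm (expectedGram H μ A B K) m := by
  -- Cauchy–Schwarz in the form `(a + κ b)² ≤ (1 + κ²)(a² + b²)`, with `a` the action response and
  -- `b` the state response.
  have hpt : ∀ w : Fin (2 * H) → Vec dx, ‖lagAction (lag w) 0 m‖ ^ 2 ≤
      (1 + κ ^ 2) * (‖stateResponse A B K w m‖ ^ 2 + ‖actionResponse A B K w m‖ ^ 2) := by
    intro w
    rw [← actionResponse_add_app A B K w m]
    have h1 := norm_add_le (actionResponse A B K w m) (app K (stateResponse A B K w m))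
    have h2 : ‖app K (stateResponse A B K w m)‖ ≤ κ * ‖stateResponse A B K w m‖ :=
      norm_app_le_of_le hK le_rfl
    have h3 := pow_le_pow_left₀ (norm_nonneg _) (h1.trans (add_le_add_right h2 _)) 2
    refine h3.trans ?_
    nlinarith [sq_nonneg (κ * ‖actionResponse A B K w m‖ - ‖stateResponse A B K w m‖)]
  have hcont : Continuous fun w : Fin (2 * H) → Vec dx =>
      ‖stateResponse A B K w m‖ ^ 2 + ‖actionResponse A B K w m‖ ^ 2 := by
    have h1 := continuous_stateResponse A B K m
    have h2 := continuous_actionResponse A B K m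
    fun_prop
  have h1 : ∫ w, ‖lagAction (lag w) 0 m‖ ^ 2 ∂(Measure.pi fun _ : Fin (2 * H) => μ) ≤
      ∫ w, (1 + κ ^ 2) * (‖stateResponse A B K w m‖ ^ 2 + ‖actionResponse A B K w m‖ ^ 2)
        ∂(Measure.pi fun _ : Fin (2 * H) => μ) :=
    integral_mono (h.integrable_pi (((continuous_lagAction 0 m).norm).pow 2))
      (h.integrable_pi (continuous_const.mul hcont)) hpt
  rw [integral_const_mul, ← sqNorm_expectedGram A B K h] at h1
  have h2 := (h.le_integral_lagAction m).trans h1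
  have hκ0 : 0 < κ := by linarith
  -- The argument yields the larger constant `σ² / (1 + κ²)`; this step weakens it to the required
  -- one.
  have h3 : γ ^ 2 * σ ^ 2 / (36 * κ ^ 10) * ‖m‖ ^ 2 ≤ σ ^ 2 * ‖m‖ ^ 2 / (1 + κ ^ 2) := by
    rw [div_mul_eq_mul_div, div_le_div_iff₀ (by positivity) (by positivity)]
    have e1 : γ ^ 2 ≤ 1 := pow_le_one₀ hγ.le hγ1.le
    have e2 : 1 + κ ^ 2 ≤ 36 * κ ^ 10 := by
      have := pow_le_pow_right₀ hκ (show 2 ≤ 10 by norm_num)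
      have := one_le_pow₀ hκ (n := 10)
      linarith
    calc γ ^ 2 * σ ^ 2 * ‖m‖ ^ 2 * (1 + κ ^ 2) = γ ^ 2 * (σ ^ 2 * ‖m‖ ^ 2 * (1 + κ ^ 2)) := by ring
      _ ≤ 1 * (σ ^ 2 * ‖m‖ ^ 2 * (36 * κ ^ 10)) := by gcongr
      _ = _ := by ring
  refine h3.trans ?_
  rw [div_le_iff₀ (by positivity)]
  linarith

theorem dotProduct_self_ofLp {ι : Type*} [Fintype ι] (m : EuclideanSpace ℝ ι) :
    m.ofLp ⬝ᵥ m.ofLp = ‖m‖ ^ 2 := by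
  rw [EuclideanSpace.norm_sq_eq]
  simp [dotProduct, sq]

theorem posSemidef_expectedGram_sub (h : NoiseLaw μ σ W) {κ γ : ℝ} (hκ : 1 ≤ κ) (hγ : 0 < γ)
    (hγ1 : γ < 1) (hK : ‖K‖ ≤ κ) :
    (expectedGram H μ A B K - (γ ^ 2 * σ ^ 2 / (36 * κ ^ 10)) •
      (1 : Matrix (Fin H × Fin du × Fin dx) (Fin H × Fin du × Fin dx) ℝ)).PosSemidef := by
  refine Matrix.PosSemidef.of_dotProduct_mulVec_nonneg ?_ fun x => ?_
  · exact (isHermitian_expectedGram A B K).sub (by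
      rw [Matrix.IsHermitian, Matrix.conjTranspose_smul, Matrix.conjTranspose_one, star_trivial])
  · have h1 := le_sqNorm_expectedGram A B K h hκ hγ hγ1 hK (WithLp.toLp 2 x)
    rw [← dotProduct_self_ofLp] at h1
    rw [Matrix.sub_mulVec, dotProduct_sub, Matrix.smul_mulVec, Matrix.one_mulVec, dotProduct_smul,
      sub_nonneg, star_trivial]
    exact h1

theorem posDef_expectedGram (h : NoiseLaw μ σ W) (hσ : 0 < σ) {κ γ : ℝ} (hκ : 1 ≤ κ) (hγ : 0 < γ)
    (hγ1 : γ < 1) (hK : ‖K‖ ≤ κ) : (expectedGram H μ A B K).PosDef := by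
  refine Matrix.PosDef.of_dotProduct_mulVec_pos (isHermitian_expectedGram A B K) fun x hx => ?_
  have h1 := le_sqNorm_expectedGram A B K h hκ hγ hγ1 hK (WithLp.toLp 2 x)
  refine lt_of_lt_of_le ?_ h1
  have : 0 < ‖(WithLp.toLp 2 x : Param H du dx)‖ := norm_pos_iff.2 (by simpa using hx)
  have hκ0 : 0 < κ := by linarith
  positivity

end Gram

/-! ### Cost functions -/

section Cost

variable {dx du : ℕ} {c : Vec dx → Vec du → ℝ} {α G W : ℝ}

theorem CostCondition.fderiv_apply_le (h : CostCondition c α G W) {D : ℝ} (hD : W ≤ D)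
    {z : Vec dx × Vec du} (h1 : ‖z.1‖ ≤ D) (h2 : ‖z.2‖ ≤ D) (v : Vec dx × Vec du) :
    |fderiv ℝ (fun z : Vec dx × Vec du => c z.1 z.2) z v| ≤ G * D * (‖v.1‖ + ‖v.2‖) := by
  obtain ⟨x, u⟩ := z
  obtain ⟨a, b⟩ := v
  have hc := (h.differentiable (x, u)).hasFDerivAt
  set L := fderiv ℝ (fun z : Vec dx × Vec du => c z.1 z.2) (x, u) with hL
  obtain ⟨g1, g2⟩ := h.grad_bound D hD x u h1 h2
  have hx : HasFDerivAt (fun x' => c x' u) (L.comp (.inl ℝ _ _)) x :=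
    hc.comp (f := fun x' => (x', u)) x (hasFDerivAt_prodMk_left x u)
  have hu : HasFDerivAt (fun u' => c x u') (L.comp (.inr ℝ _ _)) u :=
    hc.comp (f := fun u' => (x, u')) u (hasFDerivAt_prodMk_right x u)
  have ex : L (a, 0) = inner ℝ (gradient (fun x' => c x' u) x) a := by
    rw [inner_gradient_left, hx.fderiv]
    rfl
  have eu : L (0, b) = inner ℝ (gradient (fun u' => c x u') u) b := by
    rw [inner_gradient_left, hu.fderiv]
    rfl
  have e : L (a, b) = L (a, 0) + L (0, b) := by rw [← map_add]; simp
  rw [e, ex, eu, mul_add]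
  refine (abs_add_le _ _).trans (add_le_add ?_ ?_)
  · exact (abs_real_inner_le_norm _ _).trans (mul_le_mul_of_nonneg_right g1 (norm_nonneg _))
  · exact (abs_real_inner_le_norm _ _).trans (mul_le_mul_of_nonneg_right g2 (norm_nonneg _))

/-- No sign is imposed on `G`; it is read off from the gradient bound at the origin. -/
theorem CostCondition.slope_nonneg (h : CostCondition c α G W) {D : ℝ} (hD : W ≤ D)
    (hD0 : 0 ≤ D) : 0 ≤ G * D :=
  (norm_nonneg _).trans (h.grad_bound D hD 0 0 (by simpa) (by simpa)).1

theorem CostCondition.norm_fderiv_le (h : CostCondition c α G W) {D : ℝ} (hD : W ≤ D)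
    {z : Vec dx × Vec du} (h1 : ‖z.1‖ ≤ D) (h2 : ‖z.2‖ ≤ D) :
    ‖fderiv ℝ (fun z : Vec dx × Vec du => c z.1 z.2) z‖ ≤ 2 * (G * D) := by
  have hGD := h.slope_nonneg hD ((norm_nonneg _).trans h1)
  refine ContinuousLinearMap.opNorm_le_bound _ (by positivity) fun v => ?_
  refine (h.fderiv_apply_le hD h1 h2 v).trans ?_
  have := norm_fst_le v
  have := norm_snd_le v
  nlinarith

theorem CostCondition.abs_sub_le (h : CostCondition c α G W) {D : ℝ} (hD : W ≤ D)
    {x x' : Vec dx} {u u' : Vec du} (h1 : ‖x‖ ≤ D) (h2 : ‖u‖ ≤ D) (h1' : ‖x'‖ ≤ D)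
    (h2' : ‖u'‖ ≤ D) : |c x u - c x' u'| ≤ 2 * (G * D) * ‖(x, u) - (x', u')‖ := by
  have := (convex_closedBall (0 : Vec dx × Vec du) D).norm_image_sub_le_of_norm_fderiv_le
    (𝕜 := ℝ) (f := fun z : Vec dx × Vec du => c z.1 z.2) (C := 2 * (G * D))
    (x := (x', u')) (y := (x, u))
    (fun z _ => h.differentiable z)
    (fun z hz => by
      rw [mem_closedBall_zero_iff] at hz
      exact h.norm_fderiv_le hD ((norm_fst_le z).trans hz) ((norm_snd_le z).trans hz))
    (by simpa [Prod.norm_def] using ⟨h1', h2'⟩) (by simpa [Prod.norm_def] using ⟨h1, h2⟩)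
  simpa using this

theorem CostCondition.abs_sub_le_add (h : CostCondition c α G W) {D : ℝ} (hD : W ≤ D)
    {x x' : Vec dx} {u u' : Vec du} (h1 : ‖x‖ ≤ D) (h2 : ‖u‖ ≤ D) (h1' : ‖x'‖ ≤ D)
    (h2' : ‖u'‖ ≤ D) : |c x u - c x' u'| ≤ 2 * (G * D) * (‖x - x'‖ + ‖u - u'‖) := by
  refine (h.abs_sub_le hD h1 h2 h1' h2').trans (mul_le_mul_of_nonneg_left ?_ ?_)
  · rw [Prod.mk_sub_mk, Prod.norm_def]
    exact max_le (le_add_of_nonneg_right (norm_nonneg _)) (le_add_of_nonneg_left (norm_nonneg _))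
  · have := h.slope_nonneg hD ((norm_nonneg _).trans h1)
    positivity

theorem CostCondition.strong_convexity (h : CostCondition c α G W) (x x' : Vec dx)
    (u u' : Vec du) {a b : ℝ} (ha : 0 ≤ a) (hb : 0 ≤ b) (hab : a + b = 1) :
    c (a • x + b • x') (a • u + b • u') ≤ a * c x u + b * c x' u' -
      a * b * (α / 2 * (‖x - x'‖ ^ 2 + ‖u - u'‖ ^ 2)) := by
  have := h.strongConvex.2 (Set.mem_univ (WithLp.toLp 2 (x, u)))
    (Set.mem_univ (WithLp.toLp 2 (x', u'))) ha hb hab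
  beta_reduce at this
  rw [WithLp.prod_norm_sq_eq_of_L2] at this
  simpa using this

/-- At the midpoint of `± W e₁` strong convexity forces an average rise of at least `α W² / 2`,
while the Lipschitz bound allows at most `2 G W²`. The result turns error terms linear in `G` into
multiples of `G² / α`. -/
theorem CostCondition.convexity_le_slope (h : CostCondition c α G W) (hW : 0 < W) (hdx : 0 < dx) :
    α ≤ 4 * G := by
  set e : Vec dx := EuclideanSpace.single ⟨0, hdx⟩ W with he
  have hn : ‖e‖ = W := by
    rw [he, PiLp.norm_single, Real.norm_of_nonneg hW.le]
  have h1 := h.strong_convexity e (-e) 0 0 (a := 1 / 2) (b := 1 / 2) (by norm_num) (by norm_num)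
    (by norm_num)
  have e0 : (1 / 2 : ℝ) • e + (1 / 2 : ℝ) • -e = 0 := by simp
  have e1 : ‖e - -e‖ = 2 * W := by
    rw [sub_neg_eq_add, ← two_smul ℝ e, norm_smul, hn]; norm_num
  rw [e0, e1] at h1
  simp only [smul_zero, add_zero, sub_self, norm_zero] at h1
  have h2 := (abs_le.1 (h.abs_sub_le_add le_rfl (x := e) (x' := 0) (u := 0) (u' := 0) hn.le
    (by simpa using hW.le) (by simpa using hW.le) (by simpa using hW.le))).2
  have h3 := (abs_le.1 (h.abs_sub_le_add le_rfl (x := -e) (x' := 0) (u := 0) (u' := 0)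
    (by simpa using hn.le) (by simpa using hW.le) (by simpa using hW.le)
    (by simpa using hW.le))).2
  simp only [sub_zero, norm_neg, hn, norm_zero, add_zero] at h2 h3
  have h4 : α * W ^ 2 ≤ 4 * G * W ^ 2 := by nlinarith
  exact le_of_mul_le_mul_right h4 (by positivity)

end Cost

/-! ### Analysis of the surrogate cost -/

section Surrogate

variable {dx du H : ℕ} {μ : Measure (Vec dx)} {σ W : ℝ}
  (A : Matrix (Fin dx) (Fin dx) ℝ) (B : Matrix (Fin dx) (Fin du) ℝ)
  (K : Matrix (Fin du) (Fin dx) ℝ) {c : Vec dx → Vec du → ℝ} {α G : ℝ}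

/-- The linear part of the surrogate state-action pair. -/
noncomputable def pairResponse (w : Fin (2 * H) → Vec dx) :
    Param H du dx →L[ℝ] Vec dx × Vec du :=
  LinearMap.toContinuousLinearMap ((stateResponse A B K w).prod (actionResponse A B K w))

theorem pairResponse_apply (w : Fin (2 * H) → Vec dx) (N : Param H du dx) :
    pairResponse A B K w N = (stateResponse A B K w N, actionResponse A B K w N) := rfl

theorem continuous_pairResponse :
    Continuous fun w : Fin (2 * H) → Vec dx => pairResponse (du := du) A B K w :=
  continuous_clm_apply.2 fun N =>
    (continuous_stateResponse A B K N).prodMk (continuous_actionResponse A B K N)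

theorem hasFDerivAt_surrogate (M : Param H du dx) (w : Fin (2 * H) → Vec dx) :
    HasFDerivAt (fun M => (surrogateState A B K M w, surrogateAction A B K M w))
      (pairResponse A B K w) M := by
  have : (fun M : Param H du dx => (surrogateState A B K M w, surrogateAction A B K M w)) =
      fun M => (surrogateState A B K 0 w, surrogateAction A B K 0 w) + pairResponse A B K w M := by
    funext M
    have h1 := surrogateState_add A B K 0 M w
    have h2 := surrogateAction_add A B K 0 M w
    rw [zero_add] at h1 h2
    rw [h1, h2, pairResponse_apply, Prod.mk_add_mk]
  rw [this]
  exact (pairResponse A B K w).hasFDerivAt.const_add _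

theorem surrogate_eq_add (M N : Param H du dx) (w : Fin (2 * H) → Vec dx) :
    (surrogateState A B K N w, surrogateAction A B K N w) =
      (surrogateState A B K M w, surrogateAction A B K M w) + pairResponse A B K w (N - M) := by
  rw [pairResponse_apply, Prod.mk_add_mk, ← surrogateState_add, ← surrogateAction_add,
    add_sub_cancel]

theorem continuous_cost (hc : CostCondition c α G W) :
    Continuous fun z : Vec dx × Vec du => c z.1 z.2 :=
  hc.differentiable.continuous

theorem continuous_surrogate_integrand (hc : CostCondition c α G W) (M : Param H du dx) :
    Continuous fun w => c (surrogateState A B K M w) (surrogateAction A B K M w) :=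
  (continuous_cost hc).comp
    ((continuous_surrogateState A B K M).prodMk (continuous_surrogateAction A B K M))

/-- Differentiation under the integral sign. The noise is bounded and parameters in the unit ball
around `M` keep the surrogate pair in a fixed ball, where the cost is Lipschitz; a constant
therefore dominates. -/
theorem hasFDerivAt_surrogateCost (h : NoiseLaw μ σ W) (hc : CostCondition c α G W)
    (M : Param H du dx) :
    Integrable (fun w => (fderiv ℝ (fun z : Vec dx × Vec du => c z.1 z.2)
        (surrogateState A B K M w, surrogateAction A B K M w)).comp (pairResponse A B K w))
        (Measure.pi fun _ : Fin (2 * H) => μ) ∧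
    HasFDerivAt (surrogateCost μ A B K c)
      (∫ w, (fderiv ℝ (fun z : Vec dx × Vec du => c z.1 z.2)
        (surrogateState A B K M w, surrogateAction A B K M w)).comp (pairResponse A B K w)
        ∂(Measure.pi fun _ : Fin (2 * H) => μ)) M := by
  have := h.prob
  have hz : Continuous fun w : Fin (2 * H) → Vec dx =>
      (surrogateState A B K M w, surrogateAction A B K M w) :=
    (continuous_surrogateState A B K M).prodMk (continuous_surrogateAction A B K M)
  obtain ⟨C₁, hC₁⟩ :=
    (isCompact_closedBall (0 : Fin (2 * H) → Vec dx) W).exists_bound_of_continuousOn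
      hz.continuousOn
  obtain ⟨C₂, hC₂⟩ :=
    (isCompact_closedBall (0 : Fin (2 * H) → Vec dx) W).exists_bound_of_continuousOn
      (continuous_pairResponse (du := du) A B K).continuousOn
  set D := max W (C₁ + C₂) with hD
  have hmem : ∀ w : Fin (2 * H) → Vec dx, (∀ i, ‖w i‖ ≤ W) →
      w ∈ Metric.closedBall (0 : Fin (2 * H) → Vec dx) W := fun w hw =>
    mem_closedBall_zero_iff.2 ((pi_norm_le_iff_of_nonneg h.bound_nonneg).2 hw)
  have hbound : ∀ w : Fin (2 * H) → Vec dx, (∀ i, ‖w i‖ ≤ W) → ∀ N ∈ Metric.ball M 1,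
      ‖(surrogateState A B K N w, surrogateAction A B K N w)‖ ≤ D := by
    intro w hw N hN
    rw [surrogate_eq_add A B K M N w]
    have h1 := hC₁ w (hmem w hw)
    have h2 := hC₂ w (hmem w hw)
    have h3 : ‖N - M‖ ≤ 1 := by
      rw [← dist_eq_norm]
      exact (Metric.mem_ball.1 hN).le
    calc _ ≤ ‖(surrogateState A B K M w, surrogateAction A B K M w)‖ +
          ‖pairResponse A B K w (N - M)‖ := norm_add_le _ _
      _ ≤ C₁ + C₂ * 1 := add_le_add h1 (((pairResponse A B K w).le_opNorm _).trans
          (mul_le_mul h2 h3 (norm_nonneg _) ((norm_nonneg _).trans h2)))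
      _ ≤ D := by rw [mul_one]; exact le_max_right _ _
  refine hasFDerivAt_integral_of_dominated_loc_of_lip' (F := fun (N : Param H du dx) w =>
      c (surrogateState A B K N w) (surrogateAction A B K N w))
    (bound := fun _ => 2 * (G * D) * C₂)
    (Metric.ball_mem_nhds M one_pos) ?_ ?_ ?_ ?_ (integrable_const _) ?_
  · exact fun N _ => (continuous_surrogate_integrand A B K hc N).aestronglyMeasurable
  · exact h.integrable_pi (continuous_surrogate_integrand A B K hc M)
  -- The cost is differentiable but not assumed `C¹`, so its derivative is only known to be
  -- measurable, not continuous.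
  · have hfd : ProperSpace (Vec dx × Vec du →L[ℝ] ℝ) := FiniteDimensional.proper ℝ _
    have h1 : AEStronglyMeasurable (fun w : Fin (2 * H) → Vec dx =>
        fderiv ℝ (fun z : Vec dx × Vec du => c z.1 z.2)
          (surrogateState A B K M w, surrogateAction A B K M w))
        (Measure.pi fun _ : Fin (2 * H) => μ) :=
      ((measurable_fderiv ℝ _).comp hz.measurable).stronglyMeasurable.aestronglyMeasurable
    have h2 : AEStronglyMeasurable (fun w : Fin (2 * H) → Vec dx =>
        pairResponse (du := du) A B K w) (Measure.pi fun _ : Fin (2 * H) => μ) :=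
      (continuous_pairResponse A B K).aestronglyMeasurable
    exact (continuous_fst.clm_comp continuous_snd : Continuous
      fun p : (Vec dx × Vec du →L[ℝ] ℝ) × (Param H du dx →L[ℝ] Vec dx × Vec du) =>
        p.1.comp p.2).comp_aestronglyMeasurable (h1.prodMk h2)
  · filter_upwards [h.ae_pi (N := 2 * H)] with w hw N hN
    have b1 := hbound w hw N hN
    have b2 := hbound w hw M (Metric.mem_ball_self one_pos)
    have hD0 : 0 ≤ D := (norm_nonneg _).trans b2
    refine (hc.abs_sub_le (D := D) (le_max_left _ _) ((norm_fst_le _).trans b1)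
      ((norm_snd_le _).trans b1) ((norm_fst_le _).trans b2) ((norm_snd_le _).trans b2)).trans ?_
    have e : (surrogateState A B K N w, surrogateAction A B K N w) -
        (surrogateState A B K M w, surrogateAction A B K M w) = pairResponse A B K w (N - M) := by
      rw [surrogate_eq_add A B K M N w, add_sub_cancel_left]
    have hGD := hc.slope_nonneg (D := D) (le_max_left _ _) hD0
    rw [e, mul_assoc _ C₂]
    exact mul_le_mul_of_nonneg_left (((pairResponse A B K w).le_opNorm _).trans
      (mul_le_mul_of_nonneg_right (hC₂ w (hmem w hw)) (norm_nonneg _))) (by positivity)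
  · refine Filter.Eventually.of_forall fun w => ?_
    exact (hc.differentiable _).hasFDerivAt.comp M (hasFDerivAt_surrogate A B K M w)

/-- Young's inequality applied pointwise to `G D (‖J_y N‖ + ‖J_v N‖)`. For all `N` together this
says that the squared dual norm of the gradient is at most `2 (G D)²`, without mention of the
inverse matrix. -/
theorem inner_gradient_surrogateCost_le (h : NoiseLaw μ σ W) (hc : CostCondition c α G W)
    {M : Param H du dx} {D : ℝ} (hD : W ≤ D)
    (hM : ∀ w : Fin (2 * H) → Vec dx, (∀ i, ‖w i‖ ≤ W) →
      ‖surrogateState A B K M w‖ ≤ D ∧ ‖surrogateAction A B K M w‖ ≤ D) (N : Param H du dx) :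
    inner ℝ (gradient (surrogateCost μ A B K c) M) N ≤
      (G * D) ^ 2 + sqNorm (expectedGram H μ A B K) N / 2 := by
  have := h.prob
  obtain ⟨hint, hder⟩ := hasFDerivAt_surrogateCost A B K h hc M
  have hcont : Continuous fun w : Fin (2 * H) → Vec dx =>
      ‖stateResponse A B K w N‖ ^ 2 + ‖actionResponse A B K w N‖ ^ 2 := by
    have h1 := continuous_stateResponse A B K N
    have h2 := continuous_actionResponse A B K N
    fun_prop
  rw [inner_gradient_left, hder.fderiv, ContinuousLinearMap.integral_apply hint,
    sqNorm_expectedGram A B K h]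
  have h1 : (G * D) ^ 2 + (∫ w, (‖stateResponse A B K w N‖ ^ 2 + ‖actionResponse A B K w N‖ ^ 2)
      ∂(Measure.pi fun _ : Fin (2 * H) => μ)) / 2 =
      ∫ w, ((G * D) ^ 2 + (‖stateResponse A B K w N‖ ^ 2 + ‖actionResponse A B K w N‖ ^ 2) / 2)
      ∂(Measure.pi fun _ : Fin (2 * H) => μ) := by
    rw [integral_add (integrable_const _) ((h.integrable_pi hcont).div_const 2), integral_div]
    simp
  rw [h1]
  refine integral_mono_ae (hint.apply_continuousLinearMap N)
    ((integrable_const _).add ((h.integrable_pi hcont).div_const 2)) ?_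
  filter_upwards [h.ae_pi (N := 2 * H)] with w hw
  obtain ⟨b1, b2⟩ := hM w hw
  have h2 := (le_abs_self _).trans (hc.fderiv_apply_le hD
    (z := (surrogateState A B K M w, surrogateAction A B K M w)) b1 b2 (pairResponse A B K w N))
  refine h2.trans ?_
  rw [pairResponse_apply]
  nlinarith [sq_nonneg (G * D - ‖stateResponse A B K w N‖),
    sq_nonneg (G * D - ‖actionResponse A B K w N‖)]

/-- The surrogate pair is affine in the parameter, so the quadratic gain of the cost integrates to
the norm of `E[JᵀJ]` and the modulus stays `α`. This is what the natural gradient buys. -/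
theorem surrogateCost_strong_convexity (h : NoiseLaw μ σ W) (hc : CostCondition c α G W)
    (M N : Param H du dx) {a b : ℝ} (ha : 0 ≤ a) (hb : 0 ≤ b) (hab : a + b = 1) :
    surrogateCost μ A B K c (a • M + b • N) ≤ a * surrogateCost μ A B K c M +
      b * surrogateCost μ A B K c N -
      a * b * (α / 2 * sqNorm (expectedGram H μ A B K) (N - M)) := by
  have := h.prob
  have hcont : Continuous fun w : Fin (2 * H) → Vec dx =>
      ‖stateResponse A B K w (N - M)‖ ^ 2 + ‖actionResponse A B K w (N - M)‖ ^ 2 := by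
    have h1 := continuous_stateResponse A B K (N - M)
    have h2 := continuous_actionResponse A B K (N - M)
    fun_prop
  have iM := h.integrable_pi (continuous_surrogate_integrand A B K hc M)
  have iN := h.integrable_pi (continuous_surrogate_integrand A B K hc N)
  have iq := h.integrable_pi hcont
  have is : Integrable (fun w => a * c (surrogateState A B K M w) (surrogateAction A B K M w) +
      b * c (surrogateState A B K N w) (surrogateAction A B K N w))
      (Measure.pi fun _ : Fin (2 * H) => μ) := (iM.const_mul a).add (iN.const_mul b)
  rw [sqNorm_expectedGram A B K h]
  unfold surrogateCost
  rw [← integral_const_mul, ← integral_const_mul, ← integral_const_mul, ← integral_const_mul,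
    ← integral_add (iM.const_mul a) (iN.const_mul b),
    ← integral_sub is ((iq.const_mul _).const_mul _)]
  refine integral_mono (h.integrable_pi (continuous_surrogate_integrand A B K hc _))
    (is.sub ((iq.const_mul _).const_mul _)) fun w => ?_
  have e : a • M + b • N = M + b • (N - M) := by
    rw [smul_sub, show a = 1 - b by linarith, sub_smul, one_smul]
    abel
  have eN : N = M + (N - M) := by abel
  have s1 := surrogateState_add A B K M (N - M) w
  have s2 := surrogateAction_add A B K M (N - M) w
  rw [← eN] at s1 s2
  have hs := hc.strong_convexity (surrogateState A B K M w) (surrogateState A B K N w)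
    (surrogateAction A B K M w) (surrogateAction A B K N w) ha hb hab
  have c1 : surrogateState A B K (a • M + b • N) w =
      a • surrogateState A B K M w + b • surrogateState A B K N w := by
    rw [e, surrogateState_add, map_smul, s1, show a = 1 - b by linarith, sub_smul, one_smul,
      smul_add]
    abel
  have c2 : surrogateAction A B K (a • M + b • N) w =
      a • surrogateAction A B K M w + b • surrogateAction A B K N w := by
    rw [e, surrogateAction_add, map_smul, s2, show a = 1 - b by linarith, sub_smul, one_smul,
      smul_add]
    abel
  have d1 : ‖surrogateState A B K M w - surrogateState A B K N w‖ =
      ‖stateResponse A B K w (N - M)‖ := by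
    rw [s1, norm_sub_rev, add_sub_cancel_left]
  have d2 : ‖surrogateAction A B K M w - surrogateAction A B K N w‖ =
      ‖actionResponse A B K w (N - M)‖ := by
    rw [s2, norm_sub_rev, add_sub_cancel_left]
  rw [d1, d2, ← c1, ← c2] at hs
  exact hs

/-- First-order form of strong convexity of the surrogate cost in the norm of `E[Jᵀ J]`. -/
theorem surrogateCost_sub_le (h : NoiseLaw μ σ W) (hc : CostCondition c α G W)
    (M N : Param H du dx) :
    surrogateCost μ A B K c M - surrogateCost μ A B K c N ≤
      inner ℝ (gradient (surrogateCost μ A B K c) M) (M - N) -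
        α / 2 * sqNorm (expectedGram H μ A B K) (N - M) := by
  have hd := (hasFDerivAt_surrogateCost A B K h hc M).2.differentiableAt.hasFDerivAt
  set f := surrogateCost (H := H) μ A B K c with hf
  set q := α / 2 * sqNorm (expectedGram H μ A B K) (N - M) with hq
  have hline : HasDerivAt (fun t : ℝ => f (M + t • (N - M))) (fderiv ℝ f M (N - M)) 0 :=
    hd.hasLineDerivAt (N - M)
  have hslope := hline.tendsto_slope_zero_right
  simp only [zero_add, zero_smul, add_zero] at hslope
  have hlim : Filter.Tendsto (fun t : ℝ => f N - f M - (1 - t) * q) (nhdsWithin 0 (Set.Ioi 0))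
      (nhds (f N - f M - (1 - 0) * q)) := by
    refine Filter.Tendsto.mono_left (Continuous.tendsto (by fun_prop) 0) nhdsWithin_le_nhds
  -- For `0 < t < 1` strong convexity on the segment bounds the difference quotient by `f N - f M -
  -- (1 - t) * q`; then `t` tends to `0`.
  have hle : fderiv ℝ f M (N - M) ≤ f N - f M - (1 - 0) * q := by
    refine le_of_tendsto_of_tendsto hslope hlim ?_
    filter_upwards [Ioo_mem_nhdsGT (show (0 : ℝ) < 1 by norm_num)] with t ht
    have h1 := surrogateCost_strong_convexity A B K h hc M N (a := 1 - t) (b := t)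
      (by linarith [ht.2]) ht.1.le (by ring)
    have e : (1 - t) • M + t • N = M + t • (N - M) := by
      rw [smul_sub, sub_smul, one_smul]
      abel
    rw [e, ← hf, ← hq] at h1
    rw [smul_eq_mul, inv_mul_le_iff₀ ht.1]
    linarith
  have e2 : inner ℝ (gradient f M) (M - N) = -fderiv ℝ f M (N - M) := by
    rw [inner_gradient_left, ← map_neg, neg_sub]
  rw [e2]
  linarith

end Surrogate

/-! ### Online gradient descent in a quadratic norm -/

section Descent

variable {ι : Type*} [Fintype ι] {P : Matrix ι ι ℝ}

theorem sqNorm_add (hP : P.IsHermitian) (a b : EuclideanSpace ℝ ι) :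
    sqNorm P (a + b) = sqNorm P a + 2 * (a.ofLp ⬝ᵥ (P *ᵥ b.ofLp)) + sqNorm P b := by
  have hsymm : b.ofLp ⬝ᵥ (P *ᵥ a.ofLp) = a.ofLp ⬝ᵥ (P *ᵥ b.ofLp) := by
    rw [Matrix.dotProduct_mulVec, ← Matrix.mulVec_transpose, dotProduct_comm]
    congr 2
  simp only [sqNorm, WithLp.ofLp_add, Matrix.mulVec_add, dotProduct_add, add_dotProduct, hsymm]
  ring

theorem sqNorm_smul (r : ℝ) (a : EuclideanSpace ℝ ι) : sqNorm P (r • a) = r ^ 2 * sqNorm P a := by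
  simp only [sqNorm, WithLp.ofLp_smul, Matrix.mulVec_smul, dotProduct_smul, smul_dotProduct,
    smul_eq_mul]
  ring

theorem sqNorm_neg (a : EuclideanSpace ℝ ι) : sqNorm P (-a) = sqNorm P a := by
  simp [sqNorm, Matrix.mulVec_neg]

theorem sqNorm_nonneg (hP : P.PosSemidef) (a : EuclideanSpace ℝ ι) : 0 ≤ sqNorm P a := by
  have := hP.dotProduct_mulVec_nonneg a.ofLp
  rwa [star_trivial] at this

/-- Projection onto a convex set in the norm `‖·‖_P` does not increase distances to its points. -/
theorem IsProj.sqNorm_sub_le (hP : P.PosSemidef) {S : Set (EuclideanSpace ℝ ι)} (hS : Convex ℝ S)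
    {Y N Z : EuclideanSpace ℝ ι} (h : IsProj P S Y N) (hZ : Z ∈ S) :
    sqNorm P (N - Z) ≤ sqNorm P (Y - Z) := by
  obtain ⟨hN, hmin⟩ := h
  set b := (N - Y).ofLp ⬝ᵥ (P *ᵥ (Z - N).ofLp) with hb
  have hb0 : 0 ≤ b := by
    by_contra hneg
    push Not at hneg
    set q := sqNorm P (Z - N) with hq
    have hq0 : 0 ≤ q := sqNorm_nonneg hP _
    have key : ∀ t : ℝ, 0 < t → t ≤ 1 → 0 ≤ 2 * b + t * q := by
      intro t ht ht1
      have hmem : N + t • (Z - N) ∈ S := hS.add_smul_sub_mem hN hZ ⟨ht.le, ht1⟩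
      have h1 := hmin _ hmem
      have e : N + t • (Z - N) - Y = (N - Y) + t • (Z - N) := by abel
      rw [e, sqNorm_add hP.isHermitian, sqNorm_smul, WithLp.ofLp_smul, Matrix.mulVec_smul,
        dotProduct_smul, smul_eq_mul, ← hb, ← hq] at h1
      have h2 : 0 ≤ t * (2 * b + t * q) := by nlinarith
      exact nonneg_of_mul_nonneg_right h2 ht
    -- With `t ≤ -b / (q + 1)` one has `t q ≤ -b`, so `2 b + t q ≤ b < 0`, contradicting minimality
    -- along the segment; the `+ 1` covers `q = 0`.
    have h1 := key (min 1 (-b / (q + 1))) (lt_min one_pos (by apply div_pos <;> linarith))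
      (min_le_left _ _)
    have h2 : min 1 (-b / (q + 1)) * q ≤ -b := by
      calc min 1 (-b / (q + 1)) * q ≤ -b / (q + 1) * (q + 1) :=
            mul_le_mul (min_le_right _ _) (by linarith) hq0
              (div_nonneg (by linarith) (by linarith))
        _ = -b := by field_simp
    linarith
  have e1 : Y - Z = (N - Z) + (Y - N) := by abel
  have e2 : (N - Z).ofLp ⬝ᵥ (P *ᵥ (Y - N).ofLp) = b := by
    have h1 := sqNorm_add hP.isHermitian (N - Z) (Y - N)
    have h2 := sqNorm_add hP.isHermitian (N - Y) (Z - N)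
    have e3 : N - Y + (Z - N) = -(N - Z + (Y - N)) := by abel
    rw [e3, sqNorm_neg, ← sqNorm_neg (N - Y), ← sqNorm_neg (Z - N), neg_sub, neg_sub, ← hb] at h2
    linarith
  rw [e1, sqNorm_add hP.isHermitian, e2]
  have := sqNorm_nonneg hP (Y - N)
  linarith

/-- Apply the hypothesis to `r • N` and divide by `r`. The free weight `r` is needed in the last
round of the regret sum. -/
theorem inner_le_of_forall_le {g : EuclideanSpace ℝ ι} {Γ : ℝ}
    (hg : ∀ N : EuclideanSpace ℝ ι, inner ℝ g N ≤ Γ + sqNorm P N / 2) {r : ℝ} (hr : 0 < r)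
    (N : EuclideanSpace ℝ ι) : inner ℝ g N ≤ Γ / r + r * sqNorm P N / 2 := by
  have := hg (r • N)
  rw [inner_smul_right, sqNorm_smul] at this
  have h2 : r * (Γ / r + r * sqNorm P N / 2) = Γ + r ^ 2 * sqNorm P N / 2 := by
    field_simp
  exact le_of_mul_le_mul_left (h2 ▸ this) hr

variable [DecidableEq ι]

theorem sqNorm_inv_mulVec (hP : P.PosDef) (g : EuclideanSpace ℝ ι) :
    sqNorm P (WithLp.toLp 2 (P⁻¹ *ᵥ g.ofLp)) =
      inner ℝ g (WithLp.toLp 2 (P⁻¹ *ᵥ g.ofLp) : EuclideanSpace ℝ ι) := by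
  have hu : IsUnit P.det := (Matrix.isUnit_iff_isUnit_det P).1 hP.isUnit
  simp only [sqNorm]
  rw [Matrix.mulVec_mulVec, Matrix.mul_nonsing_inv P hu, Matrix.one_mulVec]
  simp [PiLp.inner_apply, dotProduct]

theorem sqNorm_descent (hP : P.PosDef) (x g : EuclideanSpace ℝ ι) (η : ℝ) :
    sqNorm P (x - η • WithLp.toLp 2 (P⁻¹ *ᵥ g.ofLp)) = sqNorm P x - 2 * η * inner ℝ g x +
      η ^ 2 * sqNorm P (WithLp.toLp 2 (P⁻¹ *ᵥ g.ofLp)) := by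
  have hu : IsUnit P.det := (Matrix.isUnit_iff_isUnit_det P).1 hP.isUnit
  have e : inner ℝ g x = x.ofLp ⬝ᵥ (P *ᵥ (P⁻¹ *ᵥ g.ofLp)) := by
    rw [Matrix.mulVec_mulVec, Matrix.mul_nonsing_inv P hu, Matrix.one_mulVec]
    simp [PiLp.inner_apply, dotProduct]
  rw [sub_eq_add_neg, ← neg_smul, sqNorm_add hP.isHermitian, sqNorm_smul, e]
  simp only [WithLp.ofLp_smul, Matrix.mulVec_smul, dotProduct_smul, smul_eq_mul]
  ring

/-- For `N = P⁻¹ g` the left side of the hypothesis is `‖N‖_P²`, half of which is absorbed from the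
right. -/
theorem sqNorm_inv_mulVec_le (hP : P.PosDef) {g : EuclideanSpace ℝ ι} {Γ : ℝ}
    (hg : ∀ N : EuclideanSpace ℝ ι, inner ℝ g N ≤ Γ + sqNorm P N / 2) :
    sqNorm P (WithLp.toLp 2 (P⁻¹ *ᵥ g.ofLp)) ≤ 2 * Γ := by
  have := hg (WithLp.toLp 2 (P⁻¹ *ᵥ g.ofLp))
  rw [← sqNorm_inv_mulVec hP] at this
  linarith

end Descent

/-- Telescoping for step sizes `s / (α t)` with strong convexity `α`. -/
theorem sum_le_of_strongly_convex_descent {α s Γ : ℝ} (hα : 0 < α) (hs : 1 ≤ s) {T : ℕ}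
    {δ a p : ℕ → ℝ} (ha : ∀ t, 0 ≤ a t)
    (hδ : ∀ t, 1 ≤ t → t ≤ T → δ t ≤ p t - α / 2 * a t)
    (hstep : ∀ t, 1 ≤ t → t < T →
      a (t + 1) ≤ a t - 2 * (s / (α * t)) * p t + (s / (α * t)) ^ 2 * (2 * Γ))
    (hlast : ∀ t, 1 ≤ t → t ≤ T → ∀ r, 0 < r → p t ≤ Γ / r + r * a t / 2) (hT : 1 ≤ T) :
    ∑ t ∈ Finset.Icc 1 T, δ t ≤ s / α * Γ * ∑ t ∈ Finset.Icc 1 T, (1 / t : ℝ) := by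
  have hs0 : 0 < s := by linarith
  -- The potential `α τ / (2 s) · a (τ + 1)` is kept on the left. Strong convexity pays for the
  -- growth of its coefficient, which is `α / (2 s) ≤ α / 2` per round because `s ≥ 1`.
  have key : ∀ τ : ℕ, τ < T → ∑ t ∈ Finset.Icc 1 τ, δ t + α * τ / (2 * s) * a (τ + 1) ≤
      s / α * Γ * ∑ t ∈ Finset.Icc 1 τ, (1 / t : ℝ) := by
    intro τ
    induction τ with
    | zero => intro _; simp
    | succ τ ih =>
      intro hτ
      have h0 := ih (by omega)
      rw [Finset.sum_Icc_succ_top (by omega), Finset.sum_Icc_succ_top (by omega)]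
      have h1 := hδ (τ + 1) (by omega) hτ.le
      have h2 := hstep (τ + 1) (by omega) hτ
      have hpos : (0 : ℝ) < ((τ + 1 : ℕ) : ℝ) := by positivity
      have h3 : α * ((τ + 1 : ℕ) : ℝ) / (2 * s) * a (τ + 1 + 1) ≤
          α * ((τ + 1 : ℕ) : ℝ) / (2 * s) * a (τ + 1) - p (τ + 1) +
            s / α * Γ * (1 / ((τ + 1 : ℕ) : ℝ)) := by
        refine (mul_le_mul_of_nonneg_left h2 (by positivity)).trans (le_of_eq ?_)
        field_simp
      have h4 : α * ((τ + 1 : ℕ) : ℝ) / (2 * s) * a (τ + 1) - α / 2 * a (τ + 1) ≤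
          α * τ / (2 * s) * a (τ + 1) := by
        have : α * ((τ + 1 : ℕ) : ℝ) / (2 * s) - α / 2 ≤ α * τ / (2 * s) := by
          rw [div_sub_div _ _ (by positivity) (by norm_num), div_le_div_iff₀ (by positivity)
            (by positivity)]
          push_cast
          have : 0 ≤ α * s * (s - 1) := by
            have := sub_nonneg.2 hs
            positivity
          nlinarith
        rw [← sub_mul]
        exact mul_le_mul_of_nonneg_right this (ha _)
      rw [mul_add]
      linarith
  obtain ⟨τ, rfl⟩ : ∃ τ, T = τ + 1 := ⟨T - 1, by omega⟩
  have h0 := key τ (by omega)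
  rw [Finset.sum_Icc_succ_top (by omega), Finset.sum_Icc_succ_top (by omega)]
  have h1 := hδ (τ + 1) (by omega) le_rfl
  have hpos : (0 : ℝ) < ((τ + 1 : ℕ) : ℝ) := by positivity
  -- No update follows round `T`, so `p T` is bounded by duality; the weight `r = α T / s`
  -- reproduces the terms that an update would have given.
  have h2 := hlast (τ + 1) (by omega) le_rfl (α * ((τ + 1 : ℕ) : ℝ) / s) (by positivity)
  have h3 : Γ / (α * ((τ + 1 : ℕ) : ℝ) / s) = s / α * Γ * (1 / ((τ + 1 : ℕ) : ℝ)) := by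
    field_simp
  have h4 : α * ((τ + 1 : ℕ) : ℝ) / s * a (τ + 1) / 2 - α / 2 * a (τ + 1) ≤
      α * τ / (2 * s) * a (τ + 1) := by
    have : α * ((τ + 1 : ℕ) : ℝ) / s / 2 - α / 2 ≤ α * τ / (2 * s) := by
      rw [div_div, div_sub_div _ _ (by positivity) (by norm_num), div_le_div_iff₀ (by positivity)
        (by positivity)]
      push_cast
      have : 0 ≤ α * s * (s - 1) := by
        have := sub_nonneg.2 hs
        positivity
      nlinarith
    have := mul_le_mul_of_nonneg_right this (ha (τ + 1))
    rw [sub_mul] at this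
    linarith
  rw [mul_add]
  linarith

/-! ### Trajectories -/

section Trajectory

variable {dx du H : ℕ}

/-- The closed loop `A - B K` decays at rate `1 - γ`, and all constants are bounded by `β`. -/
structure StableRegime (A : Matrix (Fin dx) (Fin dx) ℝ) (B : Matrix (Fin dx) (Fin du) ℝ)
    (K : Matrix (Fin du) (Fin dx) ℝ) (β γ : ℝ) : Prop where
  gamma_pos : 0 < γ
  gamma_lt : γ < 1
  inv_gamma_le : γ⁻¹ ≤ β
  one_le : 1 ≤ β
  norm_input_le : ‖B‖ ≤ β
  norm_gain_le : ‖K‖ ≤ β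
  pow_le : ∀ k : ℕ, ‖(A - B * K) ^ k‖ ≤ β ^ 2 * (1 - γ) ^ k

/-- The blocks of `M` decay at rate `1 - γ`. -/
def DecayingBlocks (β γ : ℝ) (M : Param H du dx) : Prop :=
  ∀ i : Fin H, ‖block M i‖ ≤ β ^ 4 * (1 - γ) ^ ((i : ℕ) + 1)

/-- The noise `k + 1` steps before time `t`, with `w_s = 0` for `s ≤ 0`. -/
def pastNoise (w : ℕ → Vec dx) (t k : ℕ) : Vec dx :=
  if k + 1 < t then w (t - (k + 1)) else 0

/-- Variation of constants over `k` steps. It is used from time `1` for boundedness and over the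
last `H` or `H + 1` steps for comparison with the surrogate. -/
theorem unroll {n : ℕ} {F : Matrix (Fin n) (Fin n) ℝ} {x r : ℕ → Vec n}
    (hx : ∀ t, 1 ≤ t → x (t + 1) = app F (x t) + r t) {t : ℕ} (ht : 1 ≤ t) (k : ℕ) :
    x (t + k) = app (F ^ k) (x t) + ∑ j ∈ Finset.range k, app (F ^ j) (r (t + k - 1 - j)) := by
  induction k with
  | zero => simp [app_one]
  | succ k ih =>
    rw [← add_assoc, hx _ (by omega), ih, app_add, ← app_mul, ← pow_succ', app_sum,
      Finset.sum_range_succ' _ k, pow_zero, app_one, add_assoc]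
    congr 2
    refine Finset.sum_congr rfl fun j _ => ?_
    rw [← app_mul, ← pow_succ']
    congr 2
    omega

theorem norm_sum_pow_app_le {n : ℕ} {F : Matrix (Fin n) (Fin n) ℝ} {β γ R : ℝ} (hγ : 0 < γ)
    (hγ1 : γ < 1) (hβ : γ⁻¹ ≤ β) (hF : ∀ k : ℕ, ‖F ^ k‖ ≤ β ^ 2 * (1 - γ) ^ k) {v : ℕ → Vec n}
    (k : ℕ) (hR : 0 ≤ R) (hv : ∀ j < k, ‖v j‖ ≤ R) :
    ‖∑ j ∈ Finset.range k, app (F ^ j) (v j)‖ ≤ β ^ 3 * R := by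
  calc ‖∑ j ∈ Finset.range k, app (F ^ j) (v j)‖
      ≤ ∑ j ∈ Finset.range k, β ^ 2 * (1 - γ) ^ j * R :=
        norm_sum_le_of_le _ fun j hj => norm_app_le_of_le (hF j) (hv j (Finset.mem_range.1 hj))
    _ = β ^ 2 * R * ∑ j ∈ Finset.range k, (1 - γ) ^ j := by
        rw [Finset.mul_sum]
        exact Finset.sum_congr rfl fun j _ => by ring
    _ ≤ β ^ 2 * R * β := by
        have := (sum_geometric_le hγ hγ1 k).trans hβ
        gcongr
    _ = β ^ 3 * R := by ring

theorem norm_trajectory_le {n : ℕ} {F : Matrix (Fin n) (Fin n) ℝ} {β γ R : ℝ} (hγ : 0 < γ)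
    (hγ1 : γ < 1) (hβ : γ⁻¹ ≤ β) (hF : ∀ k : ℕ, ‖F ^ k‖ ≤ β ^ 2 * (1 - γ) ^ k) {x r : ℕ → Vec n}
    (hx1 : x 1 = 0) (hx : ∀ t, 1 ≤ t → x (t + 1) = app F (x t) + r t)
    (hr : ∀ t, 1 ≤ t → ‖r t‖ ≤ R) {t : ℕ} (ht : 1 ≤ t) : ‖x t‖ ≤ β ^ 3 * R := by
  obtain ⟨k, rfl⟩ : ∃ k, t = 1 + k := ⟨t - 1, by omega⟩
  rw [unroll hx le_rfl, hx1, app_zero, zero_add]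
  exact norm_sum_pow_app_le hγ hγ1 hβ hF k ((norm_nonneg _).trans (hr 1 le_rfl))
    fun j hj => hr _ (by omega)

theorem norm_pastNoise_le {w : ℕ → Vec dx} {W : ℝ} (hW : 0 ≤ W) (hw : ∀ s, ‖w s‖ ≤ W) (t k : ℕ) :
    ‖pastNoise w t k‖ ≤ W := by
  unfold pastNoise
  split_ifs
  · exact hw _
  · simpa

theorem norm_lag_le {w : Fin (2 * H) → Vec dx} {W : ℝ} (hW : 0 ≤ W) (hw : ∀ s, ‖w s‖ ≤ W) (k : ℕ) :
    ‖lag w k‖ ≤ W := by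
  unfold lag
  split_ifs
  · exact hw _
  · simpa

theorem norm_lagAction_le {β γ W : ℝ} (hγ : 0 < γ) (hγ1 : γ < 1) (hβ : γ⁻¹ ≤ β)
    {M : Param H du dx} (hM : DecayingBlocks β γ M) {v : ℕ → Vec dx} (hW : 0 ≤ W)
    (hv : ∀ k, ‖v k‖ ≤ W) (j : ℕ) : ‖lagAction v j M‖ ≤ β ^ 5 * W := by
  have hβ0 : 0 < β := (inv_pos.2 hγ).trans_le hβ
  rw [lagAction_apply]
  calc ‖∑ i : Fin H, app (block M i) (v (j + i))‖
      ≤ ∑ i : Fin H, β ^ 4 * (1 - γ) ^ (i : ℕ) * W :=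
        norm_sum_le_of_le _ fun i _ => norm_app_le_of_le ((hM i).trans (by
          rw [pow_succ]
          refine mul_le_mul_of_nonneg_left ?_ (by positivity)
          exact mul_le_of_le_one_right (pow_nonneg (by linarith) _) (by linarith))) (hv _)
    _ = β ^ 4 * W * ∑ i ∈ Finset.range H, (1 - γ) ^ i := by
        rw [Finset.mul_sum, Finset.sum_range]
        exact Finset.sum_congr rfl fun j _ => by ring
    _ ≤ β ^ 4 * W * β := by
        have := (sum_geometric_le hγ hγ1 H).trans hβ
        gcongr
    _ = β ^ 5 * W := by ring

/-- Meant for differences of iterates, where smallness of the whole vector matters and not decay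
along the blocks; the price is a factor `H`. -/
theorem norm_lagAction_le_mul (M : Param H du dx) {v : ℕ → Vec dx} {W : ℝ}
    (hv : ∀ k, ‖v k‖ ≤ W) (j : ℕ) : ‖lagAction v j M‖ ≤ H * (‖M‖ * W) := by
  rw [lagAction_apply]
  refine (norm_sum_le_of_le _ fun i _ => (norm_app_block_le M i _).trans
    (mul_le_mul_of_nonneg_left (hv _) (norm_nonneg _))).trans (le_of_eq ?_)
  simp

variable {A : Matrix (Fin dx) (Fin dx) ℝ} {B : Matrix (Fin dx) (Fin du) ℝ}
  {K : Matrix (Fin du) (Fin dx) ℝ} {β γ W : ℝ}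

theorem StableRegime.pow_mul_le (hR : StableRegime A B K β γ) {m n : ℕ} (hmn : m ≤ n)
    (hW : 0 ≤ W) : β ^ m * W ≤ β ^ n * W :=
  mul_le_mul_of_nonneg_right (pow_le_pow_right₀ hR.one_le hmn) hW

theorem StableRegime.norm_input_add_le (hR : StableRegime A B K β γ) (hW : 0 ≤ W) {q : Vec du}
    {v : Vec dx} (hq : ‖q‖ ≤ β ^ 5 * W) (hv : ‖v‖ ≤ W) : ‖v + app B q‖ ≤ 2 * β ^ 6 * W := by
  have h1 := norm_app_le_of_le hR.norm_input_le hq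
  have h2 := hR.pow_mul_le (m := 0) (n := 6) (by norm_num) hW
  rw [pow_zero, one_mul] at h2
  refine (norm_add_le _ _).trans ((add_le_add hv h1).trans ?_)
  linarith [show β * (β ^ 5 * W) = β ^ 6 * W by ring]

theorem StableRegime.norm_action_le (hR : StableRegime A B K β γ) (hW : 0 ≤ W) {x : Vec dx}
    {q : Vec du} (hx : ‖x‖ ≤ 2 * β ^ 9 * W) (hq : ‖q‖ ≤ β ^ 5 * W) :
    ‖-app K x + q‖ ≤ 3 * β ^ 10 * W := by
  have h1 := norm_app_le_of_le hR.norm_gain_le hx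
  have h2 := hR.pow_mul_le (m := 5) (n := 10) (by norm_num) hW
  refine (norm_add_le _ _).trans ((add_le_add ((norm_neg _).le.trans h1) hq).trans ?_)
  linarith [show β * (2 * β ^ 9 * W) = 2 * β ^ 10 * W by ring]

theorem StableRegime.state_bound_le (hR : StableRegime A B K β γ) (hW : 0 ≤ W) :
    2 * β ^ 9 * W ≤ 3 * β ^ 10 * W := by
  have h2 := hR.pow_mul_le (m := 9) (n := 10) (by norm_num) hW
  have h3 : 0 ≤ β ^ 10 * W := by have := hR.one_le; positivity
  linarith

theorem StableRegime.norm_surrogate_le (hR : StableRegime A B K β γ) (hW : 0 ≤ W)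
    {M : Param H du dx} (hM : DecayingBlocks β γ M) {w : Fin (2 * H) → Vec dx}
    (hw : ∀ i, ‖w i‖ ≤ W) :
    ‖surrogateState A B K M w‖ ≤ 3 * β ^ 10 * W ∧ ‖surrogateAction A B K M w‖ ≤ 3 * β ^ 10 * W := by
  have hq := fun j => norm_lagAction_le hR.gamma_pos hR.gamma_lt hR.inv_gamma_le hM hW
    (norm_lag_le hW hw) j
  have hβ := hR.one_le
  have hs : ‖surrogateState A B K M w‖ ≤ 2 * β ^ 9 * W := by
    rw [surrogateState_eq]
    refine (norm_sum_pow_app_le (R := 2 * β ^ 6 * W) hR.gamma_pos hR.gamma_lt hR.inv_gamma_le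
      hR.pow_le (H + 1) (by positivity) fun j _ => ?_).trans (le_of_eq (by ring))
    exact hR.norm_input_add_le hW (hq _) (norm_lag_le hW hw j)
  refine ⟨hs.trans (hR.state_bound_le hW), ?_⟩
  rw [surrogateAction_eq]
  exact hR.norm_action_le hW hs (hq 0)

/-- A trajectory whose disturbance part is nearly that of the constant parameter `M` stays close to
the surrogate state and action of `M`. -/
theorem StableRegime.norm_sub_surrogate_le (hR : StableRegime A B K β γ) (hW : 0 ≤ W)
    (hH : 1 ≤ H) {M : Param H du dx} (hM : DecayingBlocks β γ M) {w : ℕ → Vec dx}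
    (hw : ∀ s, ‖w s‖ ≤ W) {x : ℕ → Vec dx} {q : ℕ → Vec du}
    (hx : ∀ t, 1 ≤ t → x (t + 1) = app (A - B * K) (x t) + (w t + app B (q t)))
    {t : ℕ} (ht : 2 * H + 2 ≤ t) {X ε ρ : ℝ} (hX : ‖x (t - (H + 1))‖ ≤ X)
    (hρ : (1 - γ) ^ H ≤ ρ) (hε : 0 ≤ ε)
    (hq : ∀ s, t - (H + 1) ≤ s → s ≤ t → ‖q s - lagAction (pastNoise w s) 0 M‖ ≤ ε) :
    ‖x t - surrogateState A B K M (fun k => w (t - 2 * H + k))‖ +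
      ‖(-app K (x t) + q t) - surrogateAction A B K M (fun k => w (t - 2 * H + k))‖ ≤
      3 * β ^ 5 * (ρ * X + ε + β ^ 4 * ρ * W) := by
  set w' : Fin (2 * H) → Vec dx := fun k => w (t - 2 * H + k) with hw'
  have hγ := hR.gamma_pos
  have hγ1 := hR.gamma_lt
  have hβ := hR.one_le
  have hX0 : 0 ≤ X := (norm_nonneg _).trans hX
  have hpow0 : 0 ≤ (1 - γ) ^ H := pow_nonneg (by linarith) _
  have hρ0 : 0 ≤ ρ := hpow0.trans hρ
  have hlag : ∀ k < 2 * H, lag w' k = w (t - (k + 1)) := by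
    intro k hk
    rw [lag, dif_pos hk, hw']
    simp only [Fin.val_rev]
    congr 1
    omega
  have hq0 : lagAction (lag w') 0 M = lagAction (pastNoise w t) 0 M := by
    rw [lagAction_apply, lagAction_apply]
    refine Finset.sum_congr rfl fun i _ => ?_
    rw [hlag _ (by omega), pastNoise, if_pos (by omega)]
  -- The two actions use the same noise except for `j = H` and `i = H - 1`, where `w (t - (2 * H +
  -- 1))` has just left the window. It meets the last block, which is of size `(1 - γ) ^ H`.
  have hdrop : ∀ j ≤ H, ‖lagAction (pastNoise w (t - 1 - j)) 0 M - lagAction (lag w') (j + 1) M‖ ≤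
      β ^ 4 * ρ * W := by
    intro j hj
    rw [lagAction_apply, lagAction_apply, ← Finset.sum_sub_distrib]
    have hterm : ∀ i : Fin H, ‖app (block M i) (pastNoise w (t - 1 - j) (0 + i)) -
        app (block M i) (lag w' (j + 1 + i))‖ ≤
        if i = ⟨H - 1, by omega⟩ then β ^ 4 * ρ * W else 0 := by
      intro i
      have hi := i.isLt
      have e : pastNoise w (t - 1 - j) (0 + i) = w (t - (j + 1 + i + 1)) := by
        rw [pastNoise, if_pos (by omega)]
        congr 1
        omega
      rw [e]
      split_ifs with h
      · by_cases h2 : j + 1 + i < 2 * H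
        · rw [hlag _ h2, sub_self, norm_zero]
          positivity
        · rw [lag_eq_zero (by omega), app_zero, sub_zero]
          refine norm_app_le_of_le ((hM i).trans ?_) (hw _)
          refine mul_le_mul_of_nonneg_left ?_ (by positivity)
          rw [h]
          simp only
          rwa [Nat.sub_add_cancel hH]
      · have : (i : ℕ) ≠ H - 1 := fun h' => h (Fin.ext h')
        rw [hlag _ (by omega), sub_self, norm_zero]
    refine (norm_sum_le_of_le _ fun i _ => hterm i).trans ?_
    rw [Finset.sum_ite_eq' Finset.univ]
    simp
  obtain ⟨t₀, rfl⟩ : ∃ t₀, t = t₀ + (H + 1) := ⟨t - (H + 1), by omega⟩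
  -- After `H + 1` unrolled steps the initial state survives only through the power `H + 1` of the
  -- closed loop; the direct noise terms cancel against those of the surrogate, leaving differences
  -- of actions.
  have hs : ‖x (t₀ + (H + 1)) - surrogateState A B K M w'‖ ≤
      β ^ 2 * (ρ * X) + β ^ 4 * (ε + β ^ 4 * ρ * W) := by
    rw [unroll hx (by omega), surrogateState_eq, add_sub_assoc, ← Finset.sum_sub_distrib]
    refine (norm_add_le _ _).trans (add_le_add ?_ ?_)
    · rw [Nat.add_sub_cancel] at hX
      refine (norm_app_le_of_le (hR.pow_le _) hX).trans ?_
      rw [mul_assoc]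
      refine mul_le_mul_of_nonneg_left (mul_le_mul_of_nonneg_right ?_ hX0) (by positivity)
      rw [pow_succ]
      exact (mul_le_of_le_one_right hpow0 (by linarith)).trans hρ
    · have e : ∀ j ∈ Finset.range (H + 1),
          app ((A - B * K) ^ j) (w (t₀ + (H + 1) - 1 - j) + app B (q (t₀ + (H + 1) - 1 - j))) -
            app ((A - B * K) ^ j) (lag w' j + app B (lagAction (lag w') (j + 1) M)) =
          app ((A - B * K) ^ j) (app B (q (t₀ + (H + 1) - 1 - j) -
            lagAction (lag w') (j + 1) M)) := by
        intro j hj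
        rw [Finset.mem_range] at hj
        rw [← app_sub, hlag j (by omega),
          show t₀ + (H + 1) - 1 - j = t₀ + (H + 1) - (j + 1) by omega,
          add_sub_add_left_eq_sub, ← app_sub]
      rw [Finset.sum_congr rfl e]
      refine (norm_sum_pow_app_le (R := β * (ε + β ^ 4 * ρ * W)) hγ hγ1 hR.inv_gamma_le hR.pow_le
        (H + 1) (by positivity) fun j hj => ?_).trans (le_of_eq (by ring))
      refine norm_app_le_of_le hR.norm_input_le ?_
      rw [← sub_add_sub_cancel _ (lagAction (pastNoise w (t₀ + (H + 1) - 1 - j)) 0 M)]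
      exact (norm_add_le _ _).trans (add_le_add (hq _ (by omega) (by omega))
        (hdrop j (by omega)))
  have ha : ‖(-app K (x (t₀ + (H + 1))) + q (t₀ + (H + 1))) - surrogateAction A B K M w'‖ ≤
      β * (β ^ 2 * (ρ * X) + β ^ 4 * (ε + β ^ 4 * ρ * W)) + ε := by
    have e : (-app K (x (t₀ + (H + 1))) + q (t₀ + (H + 1))) - surrogateAction A B K M w' =
        -app K (x (t₀ + (H + 1)) - surrogateState A B K M w') +
          (q (t₀ + (H + 1)) - lagAction (pastNoise w (t₀ + (H + 1))) 0 M) := by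
      rw [surrogateAction_eq, hq0, app_sub]
      abel
    rw [e]
    refine (norm_add_le _ _).trans (add_le_add ?_ (hq _ (by omega) le_rfl))
    rw [norm_neg]
    exact norm_app_le_of_le hR.norm_gain_le hs
  refine (add_le_add hs ha).trans ?_
  have p1 : β ^ 2 ≤ β ^ 5 := pow_le_pow_right₀ hβ (by norm_num)
  have p2 : β ^ 3 ≤ β ^ 5 := pow_le_pow_right₀ hβ (by norm_num)
  have p3 : β ^ 4 ≤ β ^ 5 := pow_le_pow_right₀ hβ (by norm_num)
  have p4 : 1 ≤ β ^ 5 := one_le_pow₀ hβ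
  have z1 : 0 ≤ ρ * X := by positivity
  have z2 : 0 ≤ β ^ 4 * ρ * W := by positivity
  nlinarith [mul_le_mul_of_nonneg_right p1 z1, mul_le_mul_of_nonneg_right p2 z1,
    mul_le_mul_of_nonneg_right p3 z2, mul_le_mul_of_nonneg_right p3 hε,
    mul_le_mul_of_nonneg_right p4 hε, mul_nonneg (pow_nonneg (zero_le_one.trans hβ) 5) z1]

/-! ### The two controllers -/

theorem state_succ {π : ℕ → Vec dx → Vec du} {w : ℕ → Vec dx} {t : ℕ} (ht : 1 ≤ t) :
    state A B π w (t + 1) =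
      app A (state A B π w t) + app B (π t (state A B π w t)) + w t := by
  obtain ⟨k, rfl⟩ : ∃ k, t = k + 1 := ⟨t - 1, by omega⟩
  rfl

theorem closed_loop_eq (K : Matrix (Fin du) (Fin dx) ℝ) (x : Vec dx) (q : Vec du) (v : Vec dx) :
    app A x + app B (-app K x + q) + v = app (A - B * K) x + (v + app B q) := by
  have : app B (-app K x) = -app B (app K x) := map_neg (Matrix.toEuclideanLin B) _
  rw [app_add B, app_sub_left, app_mul, this]
  abel

theorem disturbanceActionController_eq (M : ℕ → Param H du dx) (w : ℕ → Vec dx) (t : ℕ)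
    (x : Vec dx) : disturbanceActionController K M w t x =
      -app K x + lagAction (pastNoise w t) 0 (M t) := by
  unfold disturbanceActionController
  rw [lagAction_apply]
  congr 1
  refine Finset.sum_congr rfl fun i _ => ?_
  rw [pastNoise, zero_add]
  split_ifs
  · rfl
  · rw [app_zero]

/-- Reading `K'` as the base gain `K` plus the extra action `(K - K') x` places both controllers in
the same closed loop, so one comparison lemma serves both. -/
theorem linearController_eq (K K' : Matrix (Fin du) (Fin dx) ℝ) (w : ℕ → Vec dx) (t : ℕ)
    (x : Vec dx) : linearController K' w t x = -app K x + app (K - K') x := by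
  unfold linearController
  rw [app_sub_left]
  abel

/-- The parameter of the disturbance-action controller that imitates `u = -K' x`. -/
noncomputable def imitation (H : ℕ) (A : Matrix (Fin dx) (Fin dx) ℝ)
    (B : Matrix (Fin dx) (Fin du) ℝ) (K K' : Matrix (Fin du) (Fin dx) ℝ) : Param H du dx :=
  WithLp.toLp 2 fun p => ((K - K') * (A - B * K') ^ (p.1 : ℕ)) p.2.1 p.2.2

theorem block_imitation (K K' : Matrix (Fin du) (Fin dx) ℝ) (i : Fin H) :
    block (imitation H A B K K') i = (K - K') * (A - B * K') ^ (i : ℕ) := rfl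

/-- The natural bound is `2 κ³ (1 - γ)^i`; the condition `2 ≤ κ_B (1 - γ)` trades the factor `2` for
`κ_B` and one more power of `1 - γ`. -/
theorem imitation_mem_feasible {κ κB : ℝ} (hκ : 1 ≤ κ) (hγ : 0 < γ) (hγ1 : γ < 1)
    (hκB : 2 ≤ κB * (1 - γ)) {K K' : Matrix (Fin du) (Fin dx) ℝ}
    (hK : DiagStronglyStable A B κ γ K) (hK' : DiagStronglyStable A B κ γ K') :
    imitation H A B K K' ∈ feasible H du dx κ κB γ := by
  intro i
  rw [block_imitation]
  have h1 : ‖K - K'‖ ≤ 2 * κ := (norm_sub_le _ _).trans (by linarith [hK.norm_le, hK'.norm_le])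
  have h2 := hK'.pow_norm_le hγ1.le i
  have h3 : 0 ≤ (1 - γ) ^ (i : ℕ) := pow_nonneg (by linarith) _
  calc ‖(K - K') * (A - B * K') ^ (i : ℕ)‖ ≤ ‖K - K'‖ * ‖(A - B * K') ^ (i : ℕ)‖ :=
        Matrix.l2_opNorm_mul _ _
    _ ≤ 2 * κ * (κ ^ 2 * (1 - γ) ^ (i : ℕ)) := mul_le_mul h1 h2 (norm_nonneg _) (by linarith)
    _ = κ ^ 3 * (1 - γ) ^ (i : ℕ) * 2 := by ring
    _ ≤ κ ^ 3 * (1 - γ) ^ (i : ℕ) * (κB * (1 - γ)) := by gcongr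
    _ = _ := by ring

theorem continuous_state {π : (ℕ → Vec dx) → ℕ → Vec dx → Vec du}
    (hπ : ∀ t, Continuous fun p : (ℕ → Vec dx) × Vec dx => π p.1 t p.2) (t : ℕ) :
    Continuous fun w : ℕ → Vec dx => state A B (π w) w t := by
  rcases t with _ | t
  · exact continuous_const
  · induction t with
    | zero => exact continuous_const
    | succ t ih =>
      have h1 : Continuous fun w : ℕ → Vec dx => π w (t + 1) (state A B (π w) w (t + 1)) :=
        (hπ (t + 1)).comp (continuous_id.prodMk ih)
      exact (((continuous_app A).comp ih).add ((continuous_app B).comp h1)).add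
        (continuous_apply _)

theorem continuous_action {π : (ℕ → Vec dx) → ℕ → Vec dx → Vec du}
    (hπ : ∀ t, Continuous fun p : (ℕ → Vec dx) × Vec dx => π p.1 t p.2) (t : ℕ) :
    Continuous fun w : ℕ → Vec dx => π w t (state A B (π w) w t) :=
  (hπ t).comp (continuous_id.prodMk (continuous_state hπ t))

theorem continuous_disturbanceActionController (M : ℕ → Param H du dx) (t : ℕ) :
    Continuous fun p : (ℕ → Vec dx) × Vec dx => disturbanceActionController K M p.1 t p.2 := by
  unfold disturbanceActionController
  refine ((continuous_app K).comp continuous_snd).neg.add (continuous_finsetSum _ fun i _ => ?_)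
  split_ifs
  · exact (continuous_app _).comp ((continuous_apply _).comp continuous_fst)
  · exact continuous_const

theorem continuous_linearController (t : ℕ) :
    Continuous fun p : (ℕ → Vec dx) × Vec dx => linearController K p.1 t p.2 :=
  ((continuous_app K).comp continuous_snd).neg

theorem state_one {π : ℕ → Vec dx → Vec du} {w : ℕ → Vec dx} : state A B π w 1 = 0 := rfl

/-! ### Trajectories of the disturbance-action controller -/

section DisturbanceAction

variable {M : ℕ → Param H du dx} {w : ℕ → Vec dx}

theorem disturbanceAction_succ {t : ℕ} (ht : 1 ≤ t) :
    state A B (disturbanceActionController K M w) w (t + 1) =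
      app (A - B * K) (state A B (disturbanceActionController K M w) w t) +
        (w t + app B (lagAction (pastNoise w t) 0 (M t))) := by
  rw [state_succ ht, disturbanceActionController_eq, closed_loop_eq K]

theorem StableRegime.norm_disturbanceAction_le (hR : StableRegime A B K β γ) (hW : 0 ≤ W)
    {T : ℕ} (hM : ∀ t, 1 ≤ t → t ≤ T → DecayingBlocks β γ (M t)) (hw : ∀ s, ‖w s‖ ≤ W)
    {t : ℕ} (ht : 1 ≤ t) (htT : t ≤ T) :
    ‖state A B (disturbanceActionController K M w) w t‖ ≤ 2 * β ^ 9 * W ∧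
    ‖disturbanceActionController K M w t (state A B (disturbanceActionController K M w) w t)‖ ≤
      3 * β ^ 10 * W := by
  have hq := fun s (h1 : 1 ≤ s) (h2 : s ≤ T) => norm_lagAction_le hR.gamma_pos hR.gamma_lt
    hR.inv_gamma_le (hM s h1 h2) hW (norm_pastNoise_le hW hw s) 0
  have hs : ‖state A B (disturbanceActionController K M w) w t‖ ≤ 2 * β ^ 9 * W := by
    obtain ⟨k, rfl⟩ : ∃ k, t = 1 + k := ⟨t - 1, by omega⟩
    rw [unroll (fun t ht => disturbanceAction_succ ht) le_rfl, state_one, app_zero, zero_add]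
    refine (norm_sum_pow_app_le (R := 2 * β ^ 6 * W) hR.gamma_pos hR.gamma_lt hR.inv_gamma_le
      hR.pow_le k (by have := hR.one_le; positivity) fun j hj => ?_).trans (le_of_eq (by ring))
    exact hR.norm_input_add_le hW (hq _ (by omega) (by omega)) (hw _)
  refine ⟨hs, ?_⟩
  rw [disturbanceActionController_eq]
  exact hR.norm_action_le hW hs (hq t ht htT)

theorem StableRegime.norm_disturbanceAction_sub_surrogate_le (hR : StableRegime A B K β γ)
    (hW : 0 ≤ W) (hH : 1 ≤ H) {T : ℕ} (hM : ∀ t, 1 ≤ t → t ≤ T → DecayingBlocks β γ (M t))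
    (hw : ∀ s, ‖w s‖ ≤ W) {t : ℕ} (ht : 2 * H + 2 ≤ t) (htT : t ≤ T) {m ρ : ℝ}
    (hρ : (1 - γ) ^ H ≤ ρ) (hm : ∀ s, t - (H + 1) ≤ s → s ≤ t → ‖M s - M t‖ ≤ m) :
    ‖state A B (disturbanceActionController K M w) w t -
        surrogateState A B K (M t) (fun k => w (t - 2 * H + k))‖ +
      ‖disturbanceActionController K M w t (state A B (disturbanceActionController K M w) w t) -
        surrogateAction A B K (M t) (fun k => w (t - 2 * H + k))‖ ≤
      3 * β ^ 5 * (ρ * (2 * β ^ 9 * W) + H * (m * W) + β ^ 4 * ρ * W) := by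
  have hm0 : 0 ≤ m := (norm_nonneg _).trans (hm t (by omega) le_rfl)
  rw [disturbanceActionController_eq]
  refine hR.norm_sub_surrogate_le hW hH (hM t (by omega) htT) hw
    (q := fun t => lagAction (pastNoise w t) 0 (M t))
    (fun t ht => disturbanceAction_succ ht) ht
    (hR.norm_disturbanceAction_le hW hM hw (by omega) (by omega)).1 hρ (by positivity)
    fun s h1 h2 => ?_
  rw [← map_sub]
  refine (norm_lagAction_le_mul _ (norm_pastNoise_le hW hw s) 0).trans ?_
  gcongr
  exact hm s h1 h2

end DisturbanceAction

/-! ### Trajectories of a competing linear controller -/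

section Linear

variable {w : ℕ → Vec dx} {K' : Matrix (Fin du) (Fin dx) ℝ}

theorem linear_succ {t : ℕ} (ht : 1 ≤ t) :
    state A B (linearController K' w) w (t + 1) =
      app (A - B * K') (state A B (linearController K' w) w t) + w t := by
  have h := closed_loop_eq (A := A) (B := B) K' (state A B (linearController K' w) w t) 0 (w t)
  rw [add_zero, app_zero, add_zero] at h
  rw [← h, state_succ ht]
  rfl

theorem linear_succ_of_gain {t : ℕ} (ht : 1 ≤ t) :
    state A B (linearController K' w) w (t + 1) =
      app (A - B * K) (state A B (linearController K' w) w t) +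
        (w t + app B (app (K - K') (state A B (linearController K' w) w t))) := by
  rw [state_succ ht, linearController_eq K K', closed_loop_eq K]

theorem StableRegime.norm_linear_le (hR' : StableRegime A B K' β γ) (hw : ∀ s, ‖w s‖ ≤ W)
    {t : ℕ} (ht : 1 ≤ t) :
    ‖state A B (linearController K' w) w t‖ ≤ β ^ 3 * W ∧
    ‖linearController K' w t (state A B (linearController K' w) w t)‖ ≤ β ^ 4 * W := by
  have hs := norm_trajectory_le (x := state A B (linearController K' w) w) hR'.gamma_pos
    hR'.gamma_lt hR'.inv_gamma_le hR'.pow_le rfl (fun t ht => linear_succ ht) (fun t _ => hw t) ht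
  refine ⟨hs, ?_⟩
  unfold linearController
  rw [norm_neg]
  exact (norm_app_le_of_le hR'.norm_gain_le hs).trans (le_of_eq (by ring))

/-- Unrolling the loop of `K'` over `H` steps expresses `(K - K') x` as the action of `imitation`
plus a remainder `(K - K') (A - B K')^H` applied to an old state. This remainder, of size `2 β⁶ ρ
W`, is the only imitation error. -/
theorem StableRegime.norm_linear_sub_surrogate_le (hR : StableRegime A B K β γ)
    (hR' : StableRegime A B K' β γ) (hW : 0 ≤ W) (hH : 1 ≤ H)
    (hM : DecayingBlocks β γ (imitation H A B K K')) (hw : ∀ s, ‖w s‖ ≤ W) {t : ℕ}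
    (ht : 2 * H + 2 ≤ t) {ρ : ℝ} (hρ : (1 - γ) ^ H ≤ ρ) :
    ‖state A B (linearController K' w) w t -
        surrogateState A B K (imitation H A B K K') (fun k => w (t - 2 * H + k))‖ +
      ‖linearController K' w t (state A B (linearController K' w) w t) -
        surrogateAction A B K (imitation H A B K K') (fun k => w (t - 2 * H + k))‖ ≤
      3 * β ^ 5 * (ρ * (β ^ 3 * W) + 2 * β ^ 6 * ρ * W + β ^ 4 * ρ * W) := by
  have hβ := hR.one_le
  have hpow0 : 0 ≤ (1 - γ) ^ H := pow_nonneg (by linarith [hR.gamma_lt]) _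
  have hρ0 : 0 ≤ ρ := hpow0.trans hρ
  rw [linearController_eq K K']
  refine hR.norm_sub_surrogate_le hW hH hM hw
    (q := fun t => app (K - K') (state A B (linearController K' w) w t))
    (fun t ht => linear_succ_of_gain ht) ht (hR'.norm_linear_le hw (by omega)).1 hρ (by positivity)
    fun s h1 h2 => ?_
  obtain ⟨r, rfl⟩ : ∃ r, s = r + H := ⟨s - H, by omega⟩
  have e : app (K - K') (state A B (linearController K' w) w (r + H)) -
      lagAction (pastNoise w (r + H)) 0 (imitation H A B K K') =
      app (K - K') (app ((A - B * K') ^ H) (state A B (linearController K' w) w r)) := by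
    rw [unroll (fun t ht => linear_succ ht) (by omega), app_add (K - K'), lagAction_apply, app_sum,
      Finset.sum_range, add_sub_assoc, ← Finset.sum_sub_distrib, Finset.sum_eq_zero, add_zero]
    intro i _
    rw [block_imitation, app_mul, pastNoise, if_pos (by omega), sub_eq_zero]
    congr 3
    omega
  rw [e]
  have h3 : ‖K - K'‖ ≤ 2 * β := (norm_sub_le _ _).trans
    (by linarith [hR.norm_gain_le, hR'.norm_gain_le])
  have h4 : ‖(A - B * K') ^ H‖ ≤ β ^ 2 * ρ :=
    (hR'.pow_le H).trans (mul_le_mul_of_nonneg_left hρ (by positivity))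
  exact (norm_app_le_of_le h3 (norm_app_le_of_le h4
    (hR'.norm_linear_le hw (by omega)).1)).trans (le_of_eq (by ring))

end Linear

end Trajectory

/-! ### Expected costs along trajectories -/

section Expectation

variable {dx du H : ℕ} {μ : Measure (Vec dx)} {σ W : ℝ} {Ω : Type*} [MeasurableSpace Ω]
  {P : Measure Ω} {w : ℕ → Ω → Vec dx}

theorem NoiseLaw.ae_path (h : NoiseLaw μ σ W) (hlaw : ∀ t, HasLaw (w t) μ P) :
    ∀ᵐ ω ∂P, ∀ s, ‖w s ω‖ ≤ W := by
  rw [ae_all_iff]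
  intro s
  have h1 := h.bounded
  rw [← (hlaw s).map_eq] at h1
  exact ae_of_ae_map (hlaw s).aemeasurable h1

theorem aemeasurable_path (hlaw : ∀ t, HasLaw (w t) μ P) :
    AEMeasurable (fun ω s => w s ω) P :=
  aemeasurable_pi_lambda _ fun s => (hlaw s).aemeasurable

variable [IsProbabilityMeasure P]

/-- Consecutive noises have the product law wherever the window starts, so a surrogate cost can be
evaluated on the very noise that drives the system. This coupling reduces the comparison of expected
costs to a pathwise one. -/
theorem integral_window (hlaw : ∀ t, HasLaw (w t) μ P) (hind : iIndepFun w P) {N : ℕ} (a : ℕ)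
    {g : (Fin N → Vec dx) → ℝ} (hg : Continuous g) :
    ∫ ω, g (fun k => w (a + k) ω) ∂P = ∫ v, g v ∂(Measure.pi fun _ : Fin N => μ) := by
  have hinj : Function.Injective fun k : Fin N => a + (k : ℕ) := fun i j hij => by
    simpa [Fin.ext_iff] using hij
  have hmeas : ∀ k : Fin N, AEMeasurable (w (a + k)) P := fun k => (hlaw _).aemeasurable
  have h1 := (iIndepFun_iff_map_fun_eq_pi_map hmeas).1 (hind.precomp hinj)
  simp only [(hlaw _).map_eq] at h1
  rw [← h1, integral_map (aemeasurable_pi_lambda _ hmeas) hg.aestronglyMeasurable]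

variable {c : Vec dx → Vec du → ℝ} {α G D : ℝ}

theorem integrable_cost (h : NoiseLaw μ σ W) (hlaw : ∀ t, HasLaw (w t) μ P)
    (hc : CostCondition c α G W) {X : (ℕ → Vec dx) → Vec dx} {U : (ℕ → Vec dx) → Vec du}
    (hX : Continuous X) (hU : Continuous U) (hD : W ≤ D)
    (hXD : ∀ v : ℕ → Vec dx, (∀ s, ‖v s‖ ≤ W) → ‖X v‖ ≤ D ∧ ‖U v‖ ≤ D) :
    Integrable (fun ω => c (X fun s => w s ω) (U fun s => w s ω)) P := by
  have hD0 : 0 ≤ D := h.bound_nonneg.trans hD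
  have hcont : Continuous fun v => c (X v) (U v) := (continuous_cost hc).comp (hX.prodMk hU)
  refine Integrable.of_bound (C := |c 0 0| + 2 * (G * D) * (D + D))
    (hcont.measurable.comp_aemeasurable (aemeasurable_path hlaw)).aestronglyMeasurable ?_
  filter_upwards [h.ae_path hlaw] with ω hω
  obtain ⟨h1, h2⟩ := hXD _ hω
  have h3 := hc.abs_sub_le_add hD (x' := 0) (u' := 0) h1 h2 (by simpa) (by simpa)
  rw [sub_zero, sub_zero] at h3
  have hGD := hc.slope_nonneg hD hD0
  have h4 : 2 * (G * D) * (‖X fun s => w s ω‖ + ‖U fun s => w s ω‖) ≤ 2 * (G * D) * (D + D) := by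
    gcongr
  rw [Real.norm_eq_abs]
  have h5 := abs_add_le (c 0 0) (c (X fun s => w s ω) (U fun s => w s ω) - c 0 0)
  rw [add_sub_cancel] at h5
  linarith

theorem abs_integral_sub_surrogateCost_le (h : NoiseLaw μ σ W) (hlaw : ∀ t, HasLaw (w t) μ P)
    (hind : iIndepFun w P) (hc : CostCondition c α G W) (A : Matrix (Fin dx) (Fin dx) ℝ)
    (B : Matrix (Fin dx) (Fin du) ℝ) (K : Matrix (Fin du) (Fin dx) ℝ) (M : Param H du dx)
    {X : (ℕ → Vec dx) → Vec dx} {U : (ℕ → Vec dx) → Vec du}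
    (hX : Continuous X) (hU : Continuous U) (hD : W ≤ D)
    (hXD : ∀ v : ℕ → Vec dx, (∀ s, ‖v s‖ ≤ W) → ‖X v‖ ≤ D ∧ ‖U v‖ ≤ D)
    (hM : ∀ v : Fin (2 * H) → Vec dx, (∀ i, ‖v i‖ ≤ W) →
      ‖surrogateState A B K M v‖ ≤ D ∧ ‖surrogateAction A B K M v‖ ≤ D) (a : ℕ) {Δ : ℝ}
    (hΔ : ∀ v : ℕ → Vec dx, (∀ s, ‖v s‖ ≤ W) →
      ‖X v - surrogateState A B K M (fun k => v (a + k))‖ +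
        ‖U v - surrogateAction A B K M (fun k => v (a + k))‖ ≤ Δ) :
    |∫ ω, c (X fun s => w s ω) (U fun s => w s ω) ∂P - surrogateCost μ A B K c M| ≤
      2 * (G * D) * Δ := by
  have hshift : Continuous fun (v : ℕ → Vec dx) (k : Fin (2 * H)) => v (a + k) :=
    continuous_pi fun k => continuous_apply _
  have i1 := integrable_cost h hlaw hc hX hU hD hXD
  have i2 := integrable_cost h hlaw hc ((continuous_surrogateState A B K M).comp hshift)
    ((continuous_surrogateAction A B K M).comp hshift) hD fun v hv => hM _ fun i => hv _
  rw [surrogateCost, ← integral_window hlaw hind a (continuous_surrogate_integrand A B K hc M)]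
  simp only [Function.comp_apply] at i2
  rw [← integral_sub i1 i2]
  have hGD := hc.slope_nonneg hD (h.bound_nonneg.trans hD)
  have h1 := norm_integral_le_of_norm_le_const (μ := P) (C := 2 * (G * D) * Δ)
    (f := fun ω => c (X fun s => w s ω) (U fun s => w s ω) -
      c (surrogateState A B K M fun k => w (a + k) ω)
        (surrogateAction A B K M fun k => w (a + k) ω)) (by
      filter_upwards [h.ae_path hlaw] with ω hω
      obtain ⟨b1, b2⟩ := hXD _ hω
      obtain ⟨b3, b4⟩ := hM (fun k => w (a + k) ω) fun i => hω _
      exact (hc.abs_sub_le_add hD b1 b2 b3 b4).trans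
        (mul_le_mul_of_nonneg_left (hΔ _ hω) (by positivity)))
  simpa using h1

end Expectation

/-! ### Regret of the online natural gradient iterates on the surrogate costs -/

section Regret

variable {dx du H : ℕ} {μ : Measure (Vec dx)} {σ W : ℝ} {A : Matrix (Fin dx) (Fin dx) ℝ}
  {B : Matrix (Fin dx) (Fin du) ℝ} {K : Matrix (Fin du) (Fin dx) ℝ} {κ κB γ α G D s : ℝ}
  {c : ℕ → Vec dx → Vec du → ℝ} {η : ℕ → ℝ} {T : ℕ} {M : ℕ → Param H du dx}

theorem NaturalGradientIterates.mem_feasible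
    (hit : NaturalGradientIterates μ A B K κ κB γ c η T M) {t : ℕ} (ht : 1 ≤ t) (htT : t ≤ T) :
    M t ∈ feasible H du dx κ κB γ := by
  rcases Nat.lt_or_ge 1 t with h | h
  · obtain ⟨k, rfl⟩ : ∃ k, t = k + 1 := ⟨t - 1, by omega⟩
    exact (hit.2 k (by omega) (by omega)).1
  · rw [show t = 1 by omega]
    exact hit.1

theorem NaturalGradientIterates.sum_surrogateCost_sub_le
    (hit : NaturalGradientIterates μ A B K κ κB γ c (fun t => s / (α * t)) T M)
    (h : NoiseLaw μ σ W) (hP : (expectedGram H μ A B K).PosDef)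
    (hc : ∀ t, CostCondition (c t) α G W) (hα : 0 < α) (hs : 1 ≤ s) (hT : 1 ≤ T) (hD : W ≤ D)
    (hM : ∀ N ∈ feasible H du dx κ κB γ, ∀ v : Fin (2 * H) → Vec dx, (∀ i, ‖v i‖ ≤ W) →
      ‖surrogateState A B K N v‖ ≤ D ∧ ‖surrogateAction A B K N v‖ ≤ D)
    {N : Param H du dx} (hN : N ∈ feasible H du dx κ κB γ) :
    ∑ t ∈ Finset.Icc 1 T, (surrogateCost μ A B K (c t) (M t) - surrogateCost μ A B K (c t) N) ≤
      s / α * (G * D) ^ 2 * ∑ t ∈ Finset.Icc 1 T, (1 / t : ℝ) := by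
  have hg : ∀ t, 1 ≤ t → t ≤ T → ∀ N : Param H du dx,
      inner ℝ (gradient (surrogateCost μ A B K (c t)) (M t)) N ≤
        (G * D) ^ 2 + sqNorm (expectedGram H μ A B K) N / 2 := fun t h1 h2 N =>
    inner_gradient_surrogateCost_le A B K h (hc t) hD (hM _ (hit.mem_feasible h1 h2)) N
  refine sum_le_of_strongly_convex_descent hα hs
    (a := fun t => sqNorm (expectedGram H μ A B K) (M t - N))
    (p := fun t => inner ℝ (gradient (surrogateCost μ A B K (c t)) (M t)) (M t - N))
    (fun t => sqNorm_nonneg hP.posSemidef _) ?_ ?_ ?_ hT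
  · intro t _ _
    have := surrogateCost_sub_le A B K h (hc t) (M t) N
    rwa [← sqNorm_neg (N - M t), neg_sub] at this
  · intro t h1 h2
    refine ((hit.2 t h1 h2).sqNorm_sub_le hP.posSemidef convex_feasible hN).trans ?_
    rw [sub_right_comm, sqNorm_descent hP]
    have := sqNorm_inv_mulVec_le hP (hg t h1 h2.le)
    gcongr
  · intro t h1 h2 r hr
    exact inner_le_of_forall_le (hg t h1 h2) hr _

/-- Distance to `M t` itself does not grow under projection, so the step is no longer than the
unprojected one in the norm of `E[JᵀJ]`; the eigenvalue bound converts this to Euclidean length. -/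
theorem NaturalGradientIterates.norm_succ_sub_le
    (hit : NaturalGradientIterates μ A B K κ κB γ c η T M)
    (h : NoiseLaw μ σ W) (hσ : 0 < σ) (hκ : 1 ≤ κ) (hγ : 0 < γ) (hγ1 : γ < 1) (hK : ‖K‖ ≤ κ)
    (hc : ∀ t, CostCondition (c t) α G W) (hD : W ≤ D)
    (hM : ∀ N ∈ feasible H du dx κ κB γ, ∀ v : Fin (2 * H) → Vec dx, (∀ i, ‖v i‖ ≤ W) →
      ‖surrogateState A B K N v‖ ≤ D ∧ ‖surrogateAction A B K N v‖ ≤ D)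
    {t : ℕ} (ht : 1 ≤ t) (htT : t < T) (hη : 0 ≤ η t) :
    ‖M (t + 1) - M t‖ ≤ 12 * κ ^ 5 / (γ * σ) * (G * D) * η t := by
  have hP := posDef_expectedGram (H := H) A B K h hσ hκ hγ hγ1 hK
  have hGD := (hc t).slope_nonneg hD (h.bound_nonneg.trans hD)
  have h1 := (hit.2 t ht htT).sqNorm_sub_le hP.posSemidef convex_feasible
    (hit.mem_feasible ht htT.le)
  have h2 := sqNorm_inv_mulVec_le hP (fun N =>
    inner_gradient_surrogateCost_le A B K h (hc t) hD (hM _ (hit.mem_feasible ht htT.le)) N)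
  rw [sub_sub_cancel_left, sqNorm_neg, sqNorm_smul] at h1
  have h3 := (le_sqNorm_expectedGram A B K h hκ hγ hγ1 hK (M (t + 1) - M t)).trans
    (h1.trans (mul_le_mul_of_nonneg_left h2 (sq_nonneg _)))
  have hκ0 : 0 < κ := by linarith
  refine abs_le_of_sq_le_sq' ?_ (by positivity) |>.2
  rw [div_mul_eq_mul_div, div_le_iff₀ (by positivity)] at h3
  -- The bound obtained has the factor `36 · 2 = 72`; it is relaxed to `144 = 12²`.
  have h4 : (12 * κ ^ 5 / (γ * σ) * (G * D) * η t) ^ 2 =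
      144 * κ ^ 10 * (G * D) ^ 2 * η t ^ 2 / (γ ^ 2 * σ ^ 2) := by
    field_simp
    ring
  rw [h4, le_div_iff₀ (by positivity)]
  have h5 : 0 ≤ κ ^ 10 * (G * D) ^ 2 * η t ^ 2 := by positivity
  nlinarith

end Regret

/-! ### Drift over a short memory and summation of per-round errors -/

theorem norm_sub_le_of_norm_succ_sub_le {E : Type*} [SeminormedAddCommGroup E] {M : ℕ → E} {C : ℝ}
    {T : ℕ} (hC : 0 ≤ C) (hM : ∀ r, 1 ≤ r → r < T → ‖M (r + 1) - M r‖ ≤ C / r) {s t : ℕ}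
    (_hs : 1 ≤ s) (hst : s ≤ t) (htT : t ≤ T) (hts : t ≤ 2 * s) :
    ‖M s - M t‖ ≤ (t - s : ℕ) * (2 * C / t) := by
  rw [← dist_eq_norm]
  refine (dist_le_Ico_sum_of_dist_le hst (d := fun _ => 2 * C / t) fun {k} h1 h2 => ?_).trans
    (le_of_eq (by simp))
  rw [dist_comm, dist_eq_norm]
  refine (hM k (by omega) (by omega)).trans ?_
  have hk : (0 : ℝ) < k := by exact_mod_cast (by omega : 0 < k)
  have ht : (0 : ℝ) < t := by exact_mod_cast (by omega : 0 < t)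
  have h3 : (t : ℝ) ≤ 2 * k := by exact_mod_cast (by omega : t ≤ 2 * k)
  rw [div_le_div_iff₀ hk ht]
  nlinarith

theorem sum_one_div_le (T : ℕ) : ∑ t ∈ Finset.Icc 1 T, (1 / t : ℝ) ≤ 1 + Real.log T := by
  have h := harmonic_le_one_add_log T
  rw [harmonic_eq_sum_Icc] at h
  push_cast at h
  simpa using h

/-- Summation of per-round errors of which the first few are only bounded by a constant. -/
theorem sum_le_of_le_early_add {T k : ℕ} {e : ℕ → ℝ} {a b d : ℝ} (ha : 0 ≤ a) (hb : 0 ≤ b)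
    (hd : 0 ≤ d) (hT : 1 ≤ T)
    (h1 : ∀ t, 1 ≤ t → t ≤ T → t ≤ k → e t ≤ a)
    (h2 : ∀ t, 1 ≤ t → t ≤ T → k < t → e t ≤ b / T + d * (1 / t : ℝ)) :
    ∑ t ∈ Finset.Icc 1 T, e t ≤ k * a + b + d * (1 + Real.log T) := by
  have hT0 : (0 : ℝ) < T := by exact_mod_cast hT
  have h3 : ∀ t ∈ Finset.Icc 1 T, e t ≤ (if t ≤ k then a else 0) + b / T + d * (1 / t : ℝ) := by
    intro t ht
    rw [Finset.mem_Icc] at ht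
    split_ifs with h
    · have := h1 t ht.1 ht.2 h
      have : 0 ≤ b / T := by positivity
      have : 0 ≤ d * (1 / t : ℝ) := by positivity
      linarith
    · rw [zero_add]
      exact h2 t ht.1 ht.2 (by omega)
  refine (Finset.sum_le_sum h3).trans ?_
  rw [Finset.sum_add_distrib, Finset.sum_add_distrib, ← Finset.mul_sum]
  refine add_le_add (add_le_add ?_ ?_) (mul_le_mul_of_nonneg_left (sum_one_div_le T) hd)
  · rw [← Finset.sum_filter, Finset.sum_const, nsmul_eq_mul]
    refine mul_le_mul_of_nonneg_right ?_ ha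
    have : (Finset.Icc 1 T).filter (· ≤ k) ⊆ Finset.Icc 1 k := fun t ht => by
      simp only [Finset.mem_filter, Finset.mem_Icc] at ht ⊢
      omega
    have := Finset.card_le_card this
    rw [Nat.card_Icc, Nat.add_sub_cancel] at this
    exact_mod_cast this
  · rw [Finset.sum_const, Nat.card_Icc, Nat.add_sub_cancel, nsmul_eq_mul]
    exact le_of_eq (by field_simp)

/-! ### The regret bound -/

section Main

variable {dx du H : ℕ} {μ : Measure (Vec dx)} {σ W : ℝ} {A : Matrix (Fin dx) (Fin dx) ℝ}
  {B : Matrix (Fin dx) (Fin du) ℝ} {K K' : Matrix (Fin du) (Fin dx) ℝ} {β γ α G : ℝ}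
  {c : ℕ → Vec dx → Vec du → ℝ} {T : ℕ} {M : ℕ → Param H du dx}
  {Ω : Type*} [MeasurableSpace Ω] {P : Measure Ω} [IsProbabilityMeasure P] {w : ℕ → Ω → Vec dx}

theorem StableRegime.sum_cost_sub_surrogateCost_le (hR : StableRegime A B K β γ)
    (h : NoiseLaw μ σ W) (hlaw : ∀ t, HasLaw (w t) μ P) (hind : iIndepFun w P)
    (hc : ∀ t, CostCondition (c t) α G W) (hH : 1 ≤ H) (hT : 1 ≤ T)
    (hpow : (1 - γ) ^ H ≤ 1 / T) (hM : ∀ t, 1 ≤ t → t ≤ T → DecayingBlocks β γ (M t)) {C D : ℝ}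
    (hDdef : D = 3 * β ^ 10 * W) (hC : 0 ≤ C)
    (hstep : ∀ r, 1 ≤ r → r < T → ‖M (r + 1) - M r‖ ≤ C / r) :
    ∑ t ∈ Finset.Icc 1 T,
      (∫ ω, c t (state A B (disturbanceActionController K M fun s => w s ω) (fun s => w s ω) t)
        (disturbanceActionController K M (fun s => w s ω) t
          (state A B (disturbanceActionController K M fun s => w s ω) (fun s => w s ω) t)) ∂P -
        surrogateCost μ A B K (c t) (M t)) ≤
      (2 * H + 1 : ℕ) * (8 * (G * D) * D) +
        2 * (G * D) * (9 * β ^ 14 * W) +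
        2 * (G * D) * (3 * β ^ 5 * (H * ((H + 1) * (2 * C) * W))) *
          (1 + Real.log T) := by
  have hW := h.bound_nonneg
  have hβ := hR.one_le
  have hD : W ≤ D := by
    have := hR.pow_mul_le (m := 0) (n := 10) (by norm_num) hW
    have : 0 ≤ β ^ 10 * W := by positivity
    rw [hDdef]
    linarith
  have hGD := (hc 0).slope_nonneg hD (hW.trans hD)
  have hD0 : 0 ≤ D := hW.trans hD
  have hX := continuous_state (A := A) (B := B) (π := disturbanceActionController K M)
    (continuous_disturbanceActionController M)
  have hU := continuous_action (A := A) (B := B) (π := disturbanceActionController K M)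
    (continuous_disturbanceActionController M)
  have hXD : ∀ t, 1 ≤ t → t ≤ T → ∀ v : ℕ → Vec dx, (∀ s, ‖v s‖ ≤ W) →
      ‖state A B (disturbanceActionController K M v) v t‖ ≤ D ∧
        ‖disturbanceActionController K M v t
          (state A B (disturbanceActionController K M v) v t)‖ ≤ D := fun t h1 h2 v hv => by
    obtain ⟨a1, a2⟩ := hR.norm_disturbanceAction_le hW hM hv h1 h2
    rw [hDdef]
    exact ⟨a1.trans (hR.state_bound_le hW), a2⟩
  have hz := fun t h1 h2 (v : Fin (2 * H) → Vec dx) (hv : ∀ i, ‖v i‖ ≤ W) =>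
    hDdef.symm ▸ hR.norm_surrogate_le hW (hM t h1 h2) hv
  have hdiff := fun t h1 h2 a Δ hΔ => (le_abs_self _).trans
    (abs_integral_sub_surrogateCost_le h hlaw hind (hc t) A B K (M t)
      (X := fun v => state A B (disturbanceActionController K M v) v t)
      (U := fun v => disturbanceActionController K M v t
        (state A B (disturbanceActionController K M v) v t))
      (hX t) (hU t) hD (hXD t h1 h2) (hz t h1 h2) a (Δ := Δ) hΔ)
  refine sum_le_of_le_early_add (by positivity) (by positivity) (by positivity) hT ?_ ?_
  · intro t h1 h2 _
    -- In early rounds any window will do: all four vectors have norm at most `D`.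
    refine (hdiff t h1 h2 0 (4 * D) fun v hv => ?_).trans (le_of_eq (by ring))
    obtain ⟨a1, a2⟩ := hXD t h1 h2 v hv
    obtain ⟨a3, a4⟩ := hz t h1 h2 (fun k => v (0 + k)) fun i => hv _
    exact (add_le_add (norm_sub_le _ _) (norm_sub_le _ _)).trans (by linarith)
  · intro t h1 h2 h3
    have hT0 : (0 : ℝ) < T := by exact_mod_cast hT
    refine (hdiff t h1 h2 (t - 2 * H) _ fun v hv =>
      hR.norm_disturbanceAction_sub_surrogate_le hW hH hM hv (by omega) h2 hpow
        (m := (H + 1) * (2 * C / t)) fun r hr1 hr2 => ?_).trans ?_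
    -- From `t ≥ 2 * H + 2` and `r ≥ t - (H + 1)` follows `t ≤ 2 * r`, so each recent step is at
    -- most `2 C / t`.
    · refine (norm_sub_le_of_norm_succ_sub_le hC hstep (by omega) hr2 h2 (by omega)).trans ?_
      refine mul_le_mul_of_nonneg_right ?_ (by positivity)
      exact_mod_cast (by omega : t - r ≤ H + 1)
    · have e : 1 / (T : ℝ) * (2 * β ^ 9 * W) + H * ((H + 1) * (2 * C / t) * W) +
          β ^ 4 * (1 / T) * W = (2 * β ^ 9 * W + β ^ 4 * W) / T +
            H * ((H + 1) * (2 * C) * W) * (1 / t) := by ring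
      have e2 : 2 * β ^ 9 * W + β ^ 4 * W ≤ 3 * β ^ 9 * W := by
        have := hR.pow_mul_le (m := 4) (n := 9) (by norm_num) hW
        linarith
      rw [e]
      calc _ ≤ 2 * (G * D) * (3 * β ^ 5 * ((3 * β ^ 9 * W) / T +
            H * ((H + 1) * (2 * C) * W) * (1 / t))) := by gcongr
        _ = _ := by ring

theorem StableRegime.sum_surrogateCost_sub_cost_le (hR : StableRegime A B K β γ)
    (hR' : StableRegime A B K' β γ) (h : NoiseLaw μ σ W) (hlaw : ∀ t, HasLaw (w t) μ P)
    (hind : iIndepFun w P) (hc : ∀ t, CostCondition (c t) α G W) (hH : 1 ≤ H) (hT : 1 ≤ T)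
    (hpow : (1 - γ) ^ H ≤ 1 / T) (hM : DecayingBlocks β γ (imitation H A B K K'))
    {D : ℝ} (hDdef : D = 3 * β ^ 10 * W) :
    ∑ t ∈ Finset.Icc 1 T, (surrogateCost μ A B K (c t) (imitation H A B K K') -
      ∫ ω, c t (state A B (linearController K' fun s => w s ω) (fun s => w s ω) t)
        (linearController K' (fun s => w s ω) t
          (state A B (linearController K' fun s => w s ω) (fun s => w s ω) t)) ∂P) ≤
      (2 * H + 1 : ℕ) * (8 * (G * D) * D) +
        2 * (G * D) * (12 * β ^ 11 * W) := by
  have hW := h.bound_nonneg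
  have hβ := hR.one_le
  have hD : W ≤ D := by
    have := hR.pow_mul_le (m := 0) (n := 10) (by norm_num) hW
    have : 0 ≤ β ^ 10 * W := by positivity
    rw [hDdef]
    linarith
  have hGD := (hc 0).slope_nonneg hD (hW.trans hD)
  have hD0 : 0 ≤ D := hW.trans hD
  have hX := continuous_state (A := A) (B := B) (π := linearController K')
    continuous_linearController
  have hU := continuous_action (A := A) (B := B) (π := linearController K')
    continuous_linearController
  have hXD : ∀ t, 1 ≤ t → ∀ v : ℕ → Vec dx, (∀ s, ‖v s‖ ≤ W) →
      ‖state A B (linearController K' v) v t‖ ≤ D ∧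
        ‖linearController K' v t (state A B (linearController K' v) v t)‖ ≤ D :=
      fun t h1 v hv => by
    obtain ⟨a1, a2⟩ := hR'.norm_linear_le hv h1
    have b1 := hR.pow_mul_le (m := 3) (n := 10) (by norm_num) hW
    have b2 := hR.pow_mul_le (m := 4) (n := 10) (by norm_num) hW
    have b3 : 0 ≤ β ^ 10 * W := by positivity
    rw [hDdef]
    exact ⟨a1.trans (by linarith), a2.trans (by linarith)⟩
  have hz := fun (v : Fin (2 * H) → Vec dx) (hv : ∀ i, ‖v i‖ ≤ W) =>
    hDdef.symm ▸ hR.norm_surrogate_le hW hM hv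
  have hdiff := fun t h1 a Δ hΔ => (le_abs_self _).trans ((abs_sub_comm _ _).le.trans
    (abs_integral_sub_surrogateCost_le h hlaw hind (hc t) A B K (imitation H A B K K')
      (X := fun v => state A B (linearController K' v) v t)
      (U := fun v => linearController K' v t (state A B (linearController K' v) v t))
      (hX t) (hU t) hD (hXD t h1) hz a (Δ := Δ) hΔ))
  -- The comparison parameter is constant in time, so there is no drift term: `d = 0`.
  have key := sum_le_of_le_early_add (T := T) (k := 2 * H + 1) (d := 0)
    (a := 8 * (G * D) * D) (b := 2 * (G * D) * (12 * β ^ 11 * W))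
    (e := fun t => surrogateCost μ A B K (c t) (imitation H A B K K') -
      ∫ ω, c t (state A B (linearController K' fun s => w s ω) (fun s => w s ω) t)
        (linearController K' (fun s => w s ω) t
          (state A B (linearController K' fun s => w s ω) (fun s => w s ω) t)) ∂P)
    (by positivity) (by positivity) le_rfl hT ?_ ?_
  · rwa [zero_mul, add_zero] at key
  · intro t h1 h2 _
    refine (hdiff t h1 0 (4 * D) fun v hv => ?_).trans (le_of_eq (by ring))
    obtain ⟨a1, a2⟩ := hXD t h1 v hv
    obtain ⟨a3, a4⟩ := hz (fun k => v (0 + k)) fun i => hv _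
    exact (add_le_add (norm_sub_le _ _) (norm_sub_le _ _)).trans (by linarith)
  · intro t h1 h2 h3
    have hT0 : (0 : ℝ) < T := by exact_mod_cast hT
    refine (hdiff t h1 (t - 2 * H) _ fun v hv =>
      hR.norm_linear_sub_surrogate_le hR' hW hH hM hv (by omega) hpow).trans ?_
    have e : 1 / (T : ℝ) * (β ^ 3 * W) + 2 * β ^ 6 * (1 / T) * W + β ^ 4 * (1 / T) * W =
        (β ^ 3 * W + 2 * β ^ 6 * W + β ^ 4 * W) / T := by ring
    have e2 : β ^ 3 * W + 2 * β ^ 6 * W + β ^ 4 * W ≤ 4 * β ^ 6 * W := by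
      have := hR.pow_mul_le (m := 4) (n := 6) (by norm_num) hW
      have := hR.pow_mul_le (m := 3) (n := 6) (by norm_num) hW
      linarith
    rw [e, zero_mul, add_zero]
    calc _ ≤ 2 * (G * D) * (3 * β ^ 5 * ((4 * β ^ 6 * W) / T)) := by gcongr
      _ = _ := by ring

end Main

/-- The numerical estimate that collects all error terms of the regret bound. -/
theorem regret_arithmetic {β σ W α G s L : ℝ} {H : ℕ} (hβ : 1 ≤ β) (hσ : 0 < σ) (hσW : σ ≤ W)
    (hα : 0 < α) (hαG : α ≤ 4 * G) (hs : 1 ≤ s) (hL : 1 / 2 ≤ L) (hH : (H : ℝ) ≤ 7 * β ^ 2 * L) :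
    ((2 * H + 1 : ℕ) * (8 * (G * (3 * β ^ 10 * W)) * (3 * β ^ 10 * W)) +
        2 * (G * (3 * β ^ 10 * W)) * (9 * β ^ 14 * W) +
        2 * (G * (3 * β ^ 10 * W)) * (3 * β ^ 5 * (H * ((H + 1) *
          (2 * (12 * β ^ 6 / σ * (G * (3 * β ^ 10 * W)) * (s / α))) * W))) * (1 + L)) +
      s / α * (G * (3 * β ^ 10 * W)) ^ 2 * (1 + L) +
      ((2 * H + 1 : ℕ) * (8 * (G * (3 * β ^ 10 * W)) * (3 * β ^ 10 * W)) +
        2 * (G * (3 * β ^ 10 * W)) * (12 * β ^ 11 * W)) ≤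
      5000000 * β ^ 40 * s * (G ^ 2 * W ^ 4 / (α * σ ^ 2)) * L ^ 7 := by
  have hW : 0 < W := hσ.trans_le hσW
  have hG : 0 < G := by linarith
  have hL0 : 0 < L := by linarith
  have hβ0 : 0 < β := by linarith
  have hs0 : 0 < s := by linarith
  set V := s * (G ^ 2 * W ^ 4 / (α * σ ^ 2)) with hV
  have hV0 : 0 ≤ V := by positivity
  have u1 : s / α * G ^ 2 * W ^ 3 / σ ≤ V := by
    have e : V = s / α * G ^ 2 * W ^ 3 / σ * (W / σ) := by rw [hV]; field_simp
    rw [e]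
    exact le_mul_of_one_le_right (by positivity) ((one_le_div hσ).2 hσW)
  have u2 : s / α * G ^ 2 * W ^ 2 ≤ V := by
    have e : s / α * G ^ 2 * W ^ 3 / σ = s / α * G ^ 2 * W ^ 2 * (W / σ) := by field_simp
    refine le_trans ?_ u1
    rw [e]
    exact le_mul_of_one_le_right (by positivity) ((one_le_div hσ).2 hσW)
  -- Terms linear in `G` acquire the missing factor `G / α` from `α ≤ 4 * G`.
  have u3 : G * W ^ 2 ≤ 4 * V := by
    have h1 : G * W ^ 2 ≤ s * (4 * G / α) * (G * W ^ 2) :=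
      le_mul_of_one_le_left (by positivity)
        (one_le_mul_of_one_le_of_one_le hs ((one_le_div hα).2 hαG))
    have e : s * (4 * G / α) * (G * W ^ 2) = 4 * (s / α * G ^ 2 * W ^ 2) := by ring
    linarith
  have hβ2 : 1 ≤ β ^ 2 := one_le_pow₀ hβ
  have hβL : 1 ≤ 2 * β ^ 2 * L := by nlinarith
  have hH1 : (H : ℝ) + 1 ≤ 9 * β ^ 2 * L := by linarith
  have hH2 : ((2 * H + 1 : ℕ) : ℝ) ≤ 16 * β ^ 2 * L := by push_cast; linarith
  have h1L : 1 + L ≤ 3 * L := by linarith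
  have hp : ∀ n ≤ 40, β ^ n ≤ β ^ 40 := fun n hn => pow_le_pow_right₀ hβ hn
  -- `L` may be below `1` when `T = 2`; the bound `L ≥ 1 / 2` lifts low powers of `L` to `L ^ 7` at
  -- the cost of powers of two.
  have hL1 : L ≤ 64 * L ^ 7 := by
    have := pow_le_pow_left₀ (by norm_num) hL 6
    nlinarith
  have hL3 : L ^ 3 ≤ 16 * L ^ 7 := by
    have := mul_le_mul_of_nonneg_left (pow_le_pow_left₀ (by norm_num) hL 4) (pow_nonneg hL0.le 3)
    nlinarith
  have hone : 1 ≤ 128 * L ^ 7 := by linarith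
  have t1 : ((2 * H + 1 : ℕ) : ℝ) * (8 * (G * (3 * β ^ 10 * W)) * (3 * β ^ 10 * W)) ≤
      300000 * (β ^ 40 * (V * L ^ 7)) := by
    calc _ = ((2 * H + 1 : ℕ) : ℝ) * (72 * β ^ 20 * (G * W ^ 2)) := by ring
      _ ≤ 16 * β ^ 2 * L * (72 * β ^ 20 * (4 * V)) := by gcongr
      _ = 4608 * (β ^ 22 * (V * L)) := by ring
      _ ≤ 4608 * (β ^ 40 * (V * (64 * L ^ 7))) := by
        have := hp 22 (by norm_num)
        gcongr
      _ ≤ _ := by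
        have : 0 ≤ β ^ 40 * (V * L ^ 7) := by positivity
        linarith
  have t2 : 2 * (G * (3 * β ^ 10 * W)) * (9 * β ^ 14 * W) ≤ 27648 * (β ^ 40 * (V * L ^ 7)) := by
    calc _ = 54 * β ^ 24 * (G * W ^ 2) := by ring
      _ ≤ 54 * β ^ 40 * (4 * V * (128 * L ^ 7)) := by
        have := hp 24 (by norm_num)
        have := u3.trans (le_mul_of_one_le_right (by positivity) hone)
        gcongr
      _ = _ := by ring
  have t3 : 2 * (G * (3 * β ^ 10 * W)) * (3 * β ^ 5 * (H * ((H + 1) *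
      (2 * (12 * β ^ 6 / σ * (G * (3 * β ^ 10 * W)) * (s / α))) * W))) * (1 + L) ≤
      4000000 * (β ^ 40 * (V * L ^ 7)) := by
    calc _ = 1296 * β ^ 31 * ((H : ℝ) * (H + 1)) * (s / α * G ^ 2 * W ^ 3 / σ) * (1 + L) := by
          ring
      _ ≤ 1296 * β ^ 31 * (7 * β ^ 2 * L * (9 * β ^ 2 * L)) * V * (3 * L) := by gcongr
      _ = 244944 * (β ^ 35 * (V * L ^ 3)) := by ring
      _ ≤ 244944 * (β ^ 40 * (V * (16 * L ^ 7))) := by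
        have := hp 35 (by norm_num)
        gcongr
      _ ≤ _ := by
        have : 0 ≤ β ^ 40 * (V * L ^ 7) := by positivity
        linarith
  have t4 : s / α * (G * (3 * β ^ 10 * W)) ^ 2 * (1 + L) ≤ 1728 * (β ^ 40 * (V * L ^ 7)) := by
    calc _ = 9 * β ^ 20 * (s / α * G ^ 2 * W ^ 2) * (1 + L) := by ring
      _ ≤ 9 * β ^ 40 * V * (3 * L) := by
        have := hp 20 (by norm_num)
        gcongr
      _ = 27 * (β ^ 40 * (V * L)) := by ring
      _ ≤ 27 * (β ^ 40 * (V * (64 * L ^ 7))) := by gcongr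
      _ = _ := by ring
  have t5 : 2 * (G * (3 * β ^ 10 * W)) * (12 * β ^ 11 * W) ≤ 36864 * (β ^ 40 * (V * L ^ 7)) := by
    calc _ = 72 * β ^ 21 * (G * W ^ 2) := by ring
      _ ≤ 72 * β ^ 40 * (4 * V * (128 * L ^ 7)) := by
        have := hp 21 (by norm_num)
        have := u3.trans (le_mul_of_one_le_right (by positivity) hone)
        gcongr
      _ = _ := by ring
  have e : 5000000 * β ^ 40 * s * (G ^ 2 * W ^ 4 / (α * σ ^ 2)) * L ^ 7 =
      5000000 * (β ^ 40 * (V * L ^ 7)) := by rw [hV]; ring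
  rw [e]
  have : 0 ≤ β ^ 40 * (V * L ^ 7) := by positivity
  linarith

/-- The properties of the horizon `H = ⌈γ⁻¹ log (T κ²)⌉`. -/
theorem horizon_bounds {κ γ β : ℝ} {T H : ℕ} (hκ : 1 ≤ κ) (hγ : 0 < γ) (hγ1 : γ < 1)
    (hκβ : κ ≤ β) (hγβ : γ⁻¹ ≤ β) (hT : 2 ≤ T) (hH : H = ⌈γ⁻¹ * Real.log (T * κ ^ 2)⌉₊) :
    1 ≤ H ∧ (1 - γ) ^ H ≤ 1 / (T : ℝ) ∧ (H : ℝ) ≤ 7 * β ^ 2 * Real.log T ∧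
      1 / 2 ≤ Real.log T := by
  have hT2 : (2 : ℝ) ≤ T := by exact_mod_cast hT
  have hT0 : (0 : ℝ) < T := by linarith
  have hκ0 : 0 < κ := by linarith
  have hL : 1 / 2 ≤ Real.log T := by
    have := Real.log_le_log two_pos hT2
    have := Real.log_two_gt_d9
    linarith
  have hlogκ : 0 ≤ Real.log κ := Real.log_nonneg hκ
  have hlogκ' : Real.log κ ≤ κ := (Real.log_le_sub_one_of_pos hκ0).trans (by linarith)
  have hlog : Real.log (T * κ ^ 2) = Real.log T + 2 * Real.log κ := by
    rw [Real.log_mul hT0.ne' (by positivity), Real.log_pow]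
    norm_num
  have hγ' : 0 < γ⁻¹ := inv_pos.2 hγ
  have hpos : 0 < γ⁻¹ * Real.log (T * κ ^ 2) := by
    rw [hlog]
    exact mul_pos hγ' (by linarith)
  refine ⟨?_, ?_, ?_, hL⟩
  · rw [hH]
    exact Nat.one_le_iff_ne_zero.2 (Nat.ceil_pos.2 hpos).ne'
  · have h1 : γ⁻¹ * Real.log (T * κ ^ 2) ≤ H := by rw [hH]; exact Nat.le_ceil _
    -- The term `2 log κ ≥ 0` in the horizon is simply dropped; `1 - γ ≤ exp (-γ)` then yields `1 /
    -- T`.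
    have h2 : Real.log T ≤ γ * H := by
      rw [inv_mul_le_iff₀ hγ, hlog] at h1
      linarith
    calc (1 - γ) ^ H ≤ Real.exp (-γ) ^ H :=
          pow_le_pow_left₀ (by linarith) (Real.one_sub_le_exp_neg γ) H
      _ = Real.exp (-(γ * H)) := by rw [← Real.exp_nat_mul]; congr 1; ring
      _ ≤ Real.exp (-Real.log T) := Real.exp_le_exp.2 (by linarith)
      _ = 1 / T := by rw [Real.exp_neg, Real.exp_log hT0, one_div]
  -- The constant is `7 = 1 + 4 + 2`: the terms `β L`, `2 β²` and `1` are each bounded by a multiple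
  -- of `β² L`, using `1 ≤ 2 L`.
  · have h1 : (H : ℝ) ≤ γ⁻¹ * Real.log (T * κ ^ 2) + 1 := by
      rw [hH]
      exact (Nat.ceil_lt_add_one hpos.le).le
    have h2 : γ⁻¹ * Real.log (T * κ ^ 2) ≤ β * (Real.log T + 2 * β) := by
      rw [hlog]
      exact mul_le_mul hγβ (by linarith) (by linarith) (by linarith)
    have hβ : 1 ≤ β := hκ.trans hκβ
    have h3 : β * Real.log T ≤ β ^ 2 * Real.log T :=
      mul_le_mul_of_nonneg_right (by nlinarith) (by linarith)
    have h4 : β ^ 2 ≤ 2 * β ^ 2 * Real.log T := by nlinarith [sq_nonneg β]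
    have h5 : 1 ≤ β ^ 2 := one_le_pow₀ hβ
    nlinarith

end OnlineControl

/-! ### Assembly of the theorem -/

theorem corollary1 :
    ∃ (C : ℝ) (n : ℕ), 0 < C ∧
      ∀ (dx du : ℕ), 0 < dx → 0 < du →
      ∀ (A : Matrix (Fin dx) (Fin dx) ℝ) (B : Matrix (Fin dx) (Fin du) ℝ)
        (K₀ : Matrix (Fin du) (Fin dx) ℝ)
        (κ γ κB σ W α G s : ℝ) (T H : ℕ)
        (μ : MeasureTheory.Measure (OnlineControl.Vec dx))
        (c : ℕ → OnlineControl.Vec dx → OnlineControl.Vec du → ℝ)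
        {Ω : Type*} [MeasurableSpace Ω] (P : MeasureTheory.Measure Ω)
        [MeasureTheory.IsProbabilityMeasure P]
        (w : ℕ → Ω → OnlineControl.Vec dx)
        (M : ℕ → OnlineControl.Param H du dx),
        1 ≤ κ → 0 < γ → γ < 1 → ‖B‖ ≤ κB → 2 ≤ κB * (1 - γ) →
        0 < σ → 0 < α → 1 ≤ s → 2 ≤ T →
        OnlineControl.DiagStronglyStable A B κ γ K₀ →
        OnlineControl.NoiseLaw μ σ W →
        (∀ t, ProbabilityTheory.HasLaw (w t) μ P) →
        ProbabilityTheory.iIndepFun w P →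
        (∀ t, OnlineControl.CostCondition (c t) α G W) →
        H = ⌈γ⁻¹ * Real.log (T * κ ^ 2)⌉₊ →
        OnlineControl.NaturalGradientIterates μ A B K₀ κ κB γ c
          (fun t => s / (α * t)) T M →
        (OnlineControl.expectedGram H μ A B K₀ -
          (γ ^ 2 * σ ^ 2 / (36 * κ ^ 10)) •
            (1 : Matrix (Fin H × Fin du × Fin dx) (Fin H × Fin du × Fin dx) ℝ)).PosSemidef ∧
        ∀ K : Matrix (Fin du) (Fin dx) ℝ, OnlineControl.DiagStronglyStable A B κ γ K →
          OnlineControl.expectedCost P w A B c T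
              (OnlineControl.disturbanceActionController K₀ M) -
            OnlineControl.expectedCost P w A B c T (OnlineControl.linearController K) ≤
          C * (γ⁻¹ * κB * κ * (max dx du : ℕ)) ^ n * s *
            (G ^ 2 * W ^ 4 / (α * σ ^ 2)) * Real.log T ^ 7 := by

  refine ⟨5000000, 40, by norm_num, ?_⟩
  intro dx du hdx hdu A B K₀ κ γ κB σ W α G s T H μ c Ω _ P _ w M hκ hγ hγ1 hB hκB hσ hα hs hT hK₀
    hμ hlaw hind hc hH hit
  refine ⟨OnlineControl.posSemidef_expectedGram_sub A B K₀ hμ hκ hγ hγ1 hK₀.norm_le, ?_⟩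
  intro K hK
  -- All four factors are at least `1`, so `β` bounds each of them and can stand in for every
  -- constant of the system.
  set β : ℝ := γ⁻¹ * κB * κ * (max dx du : ℕ) with hβdef
  have hγi : 1 ≤ γ⁻¹ := (one_le_inv₀ hγ).2 hγ1.le
  have hκB1 : 1 ≤ κB := by
    by_contra hneg
    push Not at hneg
    nlinarith
  have hd1 : (1 : ℝ) ≤ (max dx du : ℕ) := by exact_mod_cast le_max_of_le_left hdx
  have m1 : 1 ≤ γ⁻¹ * κB := one_le_mul_of_one_le_of_one_le hγi hκB1
  have m2 : 1 ≤ γ⁻¹ * κB * κ := one_le_mul_of_one_le_of_one_le m1 hκ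
  have hβ2 : γ⁻¹ * κB * κ ≤ β := le_mul_of_one_le_right (by linarith) hd1
  have hβ1 : γ⁻¹ * κB ≤ β := (le_mul_of_one_le_right (by linarith) hκ).trans hβ2
  have hγβ : γ⁻¹ ≤ β := (le_mul_of_one_le_right (by linarith) hκB1).trans hβ1
  have hκBβ : κB ≤ β := (le_mul_of_one_le_left (by linarith) hγi).trans hβ1
  have hκβ : κ ≤ β := (le_mul_of_one_le_left (by linarith) m1).trans hβ2
  have hβ : 1 ≤ β := hκ.trans hκβ
  obtain ⟨hH1, hpow, hHle, hL⟩ := OnlineControl.horizon_bounds hκ hγ hγ1 hκβ hγβ hT hH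
  have hreg : ∀ K, OnlineControl.DiagStronglyStable A B κ γ K →
      OnlineControl.StableRegime A B K β γ := fun K hK =>
    ⟨hγ, hγ1, hγβ, hβ, hB.trans hκBβ, hK.norm_le.trans hκβ, fun k =>
      (hK.pow_norm_le hγ1.le k).trans (mul_le_mul_of_nonneg_right
        (pow_le_pow_left₀ (by linarith) hκβ 2) (pow_nonneg (by linarith) k))⟩
  have hR := hreg K₀ hK₀
  have hR' := hreg K hK
  have hdec : ∀ N ∈ OnlineControl.feasible H du dx κ κB γ,
      OnlineControl.DecayingBlocks β γ N := fun N hN i => by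
    refine (hN i).trans (mul_le_mul_of_nonneg_right ?_ (pow_nonneg (by linarith) _))
    calc κ ^ 3 * κB ≤ β ^ 3 * β := by gcongr
      _ = β ^ 4 := by ring
  have hW := hμ.bound_nonneg
  have hσW : σ ≤ W := abs_le_of_sq_le_sq' (hμ.sigma_sq_le hdx) hW |>.2
  have hD : W ≤ 3 * β ^ 10 * W := by
    have := hR.pow_mul_le (m := 0) (n := 10) (by norm_num) hW
    linarith
  have hGD := (hc 0).slope_nonneg hD (hW.trans hD)
  have hαG := (hc 0).convexity_le_slope (hσ.trans_le hσW) hdx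
  have hbd : ∀ N ∈ OnlineControl.feasible H du dx κ κB γ,
      ∀ v : Fin (2 * H) → OnlineControl.Vec dx, (∀ i, ‖v i‖ ≤ W) →
      ‖OnlineControl.surrogateState A B K₀ N v‖ ≤ 3 * β ^ 10 * W ∧
      ‖OnlineControl.surrogateAction A B K₀ N v‖ ≤ 3 * β ^ 10 * W := fun N hN v hv =>
    hR.norm_surrogate_le hW (hdec N hN) hv
  have hstar := OnlineControl.imitation_mem_feasible (H := H) hκ hγ hγ1 hκB hK₀ hK
  have hP := OnlineControl.posDef_expectedGram (H := H) A B K₀ hμ hσ hκ hγ hγ1 hK₀.norm_le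
  have hstep : ∀ r, 1 ≤ r → r < T → ‖M (r + 1) - M r‖ ≤
      12 * β ^ 6 / σ * (G * (3 * β ^ 10 * W)) * (s / α) / r := by
    intro r hr1 hr2
    have hr0 : (0 : ℝ) < r := by exact_mod_cast hr1
    have hη : 0 ≤ s / (α * r) := by positivity
    refine (hit.norm_succ_sub_le hμ hσ hκ hγ hγ1 hK₀.norm_le hc hD hbd hr1 hr2 hη).trans ?_
    -- The sixth power of `β` absorbs `γ⁻¹`.
    have h1 : 12 * κ ^ 5 / (γ * σ) ≤ 12 * β ^ 6 / σ := by
      calc 12 * κ ^ 5 / (γ * σ) = 12 * (κ ^ 5 * γ⁻¹) / σ := by field_simp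
        _ ≤ 12 * (β ^ 5 * β) / σ := by gcongr
        _ = 12 * β ^ 6 / σ := by ring
    calc 12 * κ ^ 5 / (γ * σ) * (G * (3 * β ^ 10 * W)) * (s / (α * r))
        ≤ 12 * β ^ 6 / σ * (G * (3 * β ^ 10 * W)) * (s / (α * r)) := by gcongr
      _ = _ := by field_simp
  have b1 := hR.sum_cost_sub_surrogateCost_le (T := T) hμ hlaw hind hc hH1 (by omega) hpow
    (fun t h1 h2 => hdec _ (hit.mem_feasible h1 h2)) rfl (by positivity) hstep
  have b2 := hit.sum_surrogateCost_sub_le hμ hP hc hα hs (by omega) hD hbd hstar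
  have b3 := hR.sum_surrogateCost_sub_cost_le (T := T) hR' hμ hlaw hind hc hH1 (by omega) hpow
    (hdec _ hstar) rfl
  have b2' : s / α * (G * (3 * β ^ 10 * W)) ^ 2 * ∑ t ∈ Finset.Icc 1 T, (1 / t : ℝ) ≤
      s / α * (G * (3 * β ^ 10 * W)) ^ 2 * (1 + Real.log T) :=
    mul_le_mul_of_nonneg_left (OnlineControl.sum_one_div_le T) (by positivity)
  refine le_trans ?_ (OnlineControl.regret_arithmetic hβ hσ hσW hα hαG hs hL hHle)
  -- In the sum of the three differences the surrogate costs cancel round by round; integrability of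
  -- each cost is needed to exchange expectation and sum.
  refine le_trans (le_of_eq ?_) (add_le_add (add_le_add b1 (b2.trans b2')) b3)
  rw [← Finset.sum_add_distrib, ← Finset.sum_add_distrib, OnlineControl.expectedCost,
    OnlineControl.expectedCost, MeasureTheory.integral_finsetSum,
    MeasureTheory.integral_finsetSum, ← Finset.sum_sub_distrib]
  · exact Finset.sum_congr rfl fun t _ => by ring
  · intro t ht
    have ht1 := (Finset.mem_Icc.1 ht).1
    refine OnlineControl.integrable_cost hμ hlaw (hc t)
      (OnlineControl.continuous_state (π := OnlineControl.linearController K)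
        OnlineControl.continuous_linearController t)
      (OnlineControl.continuous_action (π := OnlineControl.linearController K)
        OnlineControl.continuous_linearController t)
      (D := β ^ 4 * W + W) (by have : 0 ≤ β ^ 4 * W := by positivity
                               linarith) fun v hv => ?_
    obtain ⟨a1, a2⟩ := hR'.norm_linear_le hv ht1
    have := hR.pow_mul_le (m := 3) (n := 4) (by norm_num) hW
    exact ⟨by linarith, a2.trans (by linarith)⟩
  · intro t ht
    obtain ⟨ht1, ht2⟩ := Finset.mem_Icc.1 ht
    refine OnlineControl.integrable_cost hμ hlaw (hc t)
      (OnlineControl.continuous_state (π := OnlineControl.disturbanceActionController K₀ M)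
        (OnlineControl.continuous_disturbanceActionController M) t)
      (OnlineControl.continuous_action (π := OnlineControl.disturbanceActionController K₀ M)
        (OnlineControl.continuous_disturbanceActionController M) t) hD fun v hv => ?_
    obtain ⟨a1, a2⟩ := hR.norm_disturbanceAction_le hW
      (fun t h1 h2 => hdec _ (hit.mem_feasible h1 h2)) hv ht1 ht2
    exact ⟨a1.trans (hR.state_bound_le hW), a2⟩
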